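/- **Large deviations principles.** A sequence $\{\tau_n\}$ of probability measures on the Borel $\sigma$-algebra of $\mathbb R$ satisfies a (full) large deviations principle (LDP) with rate function $\rho$ if $\rho:\mathbb R\to[0,\infty]$ is lower semicontinuous (its level sets are not required to be compact) and $$\limsup_{n\to\infty}\tfrac1n\log\tau_n(F)\le-\inf_{a\in F}\rho(a),\qquad \liminf_{n\to\infty}\tfrac1n\log\tau_n(G)\ge-\inf_{a\in G}\rho(a)$$ for all closed $F\subset\mathbb R$ and all open $G\subset\mathbb R$ (with $\log 0=-\infty$). Random variables satisfy an LDP if their laws do. **Model.** Let $\mathcal E$ be a metric space, let $\lambda,\kappa,\mu:\mathcal E\to[0,\infty)$ be continuous, and let $J=(J(s))_{s\ge0}$ be an $\mathcal E$-valued stochastic process with càdlàg paths. In the modulated infinite-server queue $(J,\lambda,\kappa,\mu)$, starting empty, job $k$ ($k\ge1$) arrives at time $\tau_k=\inf\{s\ge0:\int_0^s\lambda(J(r))\,dr\ge\bar\tau_k\}$ (with $\inf\emptyset=\infty$), where $\bar\tau_1<\bar\tau_2<\cdots$ are the jump times of a standard (unit-rate) Poisson process. Its service requirement is $Z_k=\bar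 Z_k/\kappa(J(\tau_k))$ if $\kappa(J(\tau_k))>0$ and $Z_k=\infty$ otherwise, where $\bar Z_1,\bar Z_2,\dots$ are i.i.d. standard exponential random variables; $J$, the Poisson process and $(\bar Z_k)_k$ are independent. The number of jobs in the system at time $t\ge0$ is $$M(t)=\#\Bigl\{k\ge1:\ \tau_k\le t,\ Z_k>\int_{\tau_k}^t\mu(J(r))\,dr\Bigr\}.$$ **Theorem.** Fix $t\ge0$. For $n\in\mathbb N$ let $J_n$ be an $\mathcal E$-valued càdlàg process, let $M_n(t)$ be the number of jobs at time $t$ in the queue $(J_n,n\lambda,\kappa,\mu)$, and let $\nu_n$ be the law of $$\phi_t(J_n)=\int_0^t\lambda(J_n(s))\exp\Bigl(-\kappa(J_n(s))\int_s^t\mu(J_n(r))\,dr\Bigr)ds .$$ Suppose that $\{\nu_n\}$ satisfies an LDP with rate function $\psi$ (not necessarily good). Let $\mathcal R(t)$ be the set of attainable parameters: all $\gamma\in[0,\infty)$ such that for every $\epsilon>0$ there is $N_\epsilon$ with $\nu_n\bigl((\gamma-\epsilon,\gamma+\epsilon)\bigr)>0$ for all $n\ge N_\epsilon$. For $\gamma\ge0$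 let $\ell(\gamma;\cdot)$ be the Fenchel–Legendre transform of the cumulant generating function of the Poisson distribution with parameter $\gamma$, i.e. $\ell(\gamma;a)=\sup_{\theta\in\mathbb R}[\theta a-\gamma(e^\theta-1)]$. Then $\frac1nM_n(t)$ satisfies an LDP with rate function $$I(a)=\inf_{\gamma\in\mathcal R(t)}\bigl[\ell(\gamma;a)+\psi(\gamma)\bigr],\qquad a\in\mathbb R .$$ -/

import Mathlib

open MeasureTheory ProbabilityTheory Filter Topology Set
open scoped NNReal ENNReal

namespace ModulatedQueue

noncomputable section

/-! ### Large deviations principles -/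

/-- A sequence `τ` of Borel measures on `X` satisfies a (full) large deviations principle with
rate function `ρ : X → [0, ∞]`: `ρ` is lower semicontinuous (its level sets need not be compact),
and the upper bound holds for all closed sets, the lower bound for all open sets.
Here `ENNReal.log 0 = -∞`, and the infimum over the empty set is `∞`. -/
structure SatisfiesLDP {X : Type*} [TopologicalSpace X] [MeasurableSpace X]
    (τ : ℕ → Measure X) (ρ : X → ℝ≥0∞) : Prop where
  lowerSemicontinuous : LowerSemicontinuous ρ
  upper_bound : ∀ F : Set X, IsClosed F →
    limsup (fun n : ℕ => ENNReal.log (τ n F) / (n : EReal)) atTop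
      ≤ -((⨅ a ∈ F, ρ a : ℝ≥0∞) : EReal)
  lower_bound : ∀ G : Set X, IsOpen G →
    -((⨅ a ∈ G, ρ a : ℝ≥0∞) : EReal)
      ≤ liminf (fun n : ℕ => ENNReal.log (τ n G) / (n : EReal)) atTop

/-- The Fenchel-Legendre transform `a ↦ sup_θ [θ a - Λ(θ)]` of the cumulant generating function
`Λ` of the Poisson distribution with parameter `γ ≥ 0`. The supremum is nonnegative because the
term at `θ = 0` vanishes, so truncating each term at `0` does not change it. -/
def poissonRate (γ : ℝ≥0) (a : ℝ) : ℝ≥0∞ :=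
  ⨆ θ : ℝ, ENNReal.ofReal (θ * a - cgf (fun k : ℕ => (k : ℝ)) (poissonMeasure γ) θ)

/-- `γ ≥ 0` is attainable for the sequence `ν` of laws of the random parameter: every ball around
`γ` is charged by all but finitely many of the measures. -/
def attainable (ν : ℕ → Measure ℝ) : Set ℝ≥0 :=
  {γ | ∀ ε : ℝ, 0 < ε → ∃ N : ℕ, ∀ n ≥ N, 0 < ν n (Metric.ball (γ : ℝ) ε)}

/-- The function `I(a) = inf_{γ attainable} [ℓ(γ; a) + ψ(γ)]`. -/
def mixedRate (ν : ℕ → Measure ℝ) (ψ : ℝ → ℝ≥0∞) (a : ℝ) : ℝ≥0∞ :=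
  ⨅ γ ∈ attainable ν, (poissonRate γ a + ψ (γ : ℝ))

/-! ### The queue, path by path -/

section Path

variable {E : Type*}

/-- Càdlàg paths `[0, ∞) → E`: right-continuous with left limits in `E`. -/
def IsCadlag [TopologicalSpace E] (f : ℝ≥0 → E) : Prop :=
  ∀ t, ContinuousWithinAt f (Ici t) t ∧ ∃ l, Tendsto f (𝓝[<] t) (𝓝 l)

/-- The integral `∫_u^v c(f(r)) dr` of the modulated rate `c` along the background path `f`. -/
def cumulative (c : E → ℝ≥0) (f : ℝ≥0 → E) (u v : ℝ≥0) : ℝ :=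
  ∫ r in (u : ℝ)..(v : ℝ), (c (f r.toNNReal) : ℝ)

/-- The random parameter
`φ_t(f) = ∫_0^t lam(f(s)) exp(-kap(f(s)) ∫_s^t mu(f(r)) dr) ds`. -/
def randomParameter (lam kap mu : E → ℝ≥0) (t : ℝ≥0) (f : ℝ≥0 → E) : ℝ :=
  ∫ s in (0 : ℝ)..(t : ℝ), (lam (f s.toNNReal) : ℝ) *
    Real.exp (-((kap (f s.toNNReal) : ℝ) * cumulative mu f s.toNNReal t))

/-- The time of arrival `τ_k = inf {s ≥ 0 | ∫_0^s lam(f(r)) dr ≥ τbar_k}` of job `k`, where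
`τbar_k = σ_0 + ... + σ_k` is the `k`-th jump time of the unit-rate Poisson process with
interarrival times `σ`, and jobs are numbered from `0`. It is the `k`-th jump time of the
time-changed process, and is `∞` if job `k` never arrives. -/
def arrivalTime (lam : E → ℝ≥0) (f : ℝ≥0 → E) (σ : ℕ → ℝ) (k : ℕ) : ℝ≥0∞ :=
  ⨅ (s : ℝ≥0) (_ : ∑ i ∈ Finset.range (k + 1), σ i ≤ cumulative lam f 0 s), (s : ℝ≥0∞)

/-- The service requirement of a job that arrives when the background process is in state `x`,
where `z` is its standard exponential variable: `z / kap(x)`, or `∞` if `kap(x) = 0`. -/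
def serviceRequirement (kap : E → ℝ≥0) (x : E) (z : ℝ) : EReal :=
  if 0 < kap x then ((z / (kap x : ℝ) : ℝ) : EReal) else ⊤

/-- The number of jobs in the system at time `t`: the number of `k` such that job `k` has arrived
by time `t`, and the work done by its server since then is less than its service requirement. -/
def jobsInSystem (lam kap mu : E → ℝ≥0) (f : ℝ≥0 → E) (σ z : ℕ → ℝ) (t : ℝ≥0) : ℕ :=
  {k : ℕ | arrivalTime lam f σ k ≤ (t : ℝ≥0∞) ∧
    ((cumulative mu f (arrivalTime lam f σ k).toNNReal t : ℝ) : EReal)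
      < serviceRequirement kap (f (arrivalTime lam f σ k).toNNReal) (z k)}.ncard

end Path

/-! ### The stochastic ingredients of the queue -/

/-- The random input of a modulated infinite-server queue on `(Ω, P)`: a background process `J`
with càdlàg paths, the interarrival times `σ` of a standard Poisson process (i.i.d. standard
exponential), and i.i.d. standard exponential variables `Z` for the service requirements,
the three being independent. -/
structure IsQueueInput {Ω E : Type*} [MeasurableSpace Ω] [TopologicalSpace E] [MeasurableSpace E]
    (P : Measure Ω) (J : ℝ≥0 → Ω → E) (σ Z : ℕ → Ω → ℝ) : Prop where
  measurable_background : ∀ s, Measurable (J s)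
  cadlag : ∀ ω, IsCadlag (fun s => J s ω)
  measurable_interarrival : ∀ k, Measurable (σ k)
  measurable_service : ∀ k, Measurable (Z k)
  law_interarrival : ∀ k, HasLaw (σ k) (expMeasure 1) P
  law_service : ∀ k, HasLaw (Z k) (expMeasure 1) P
  /-- All the exponential variables are mutually independent. -/
  indep_exponentials : iIndepFun (fun i : ℕ ⊕ ℕ => Sum.elim σ Z i) P
  /-- The background process is independent of the exponential variables jointly. -/
  indep_background : IndepFun (fun ω (s : ℝ≥0) => J s ω)
    (fun ω (i : ℕ ⊕ ℕ) => Sum.elim σ Z i ω) P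

/-- The law of `φ_t(J)`. -/
def parameterLaw {Ω E : Type*} [MeasurableSpace Ω] (P : Measure Ω) (lam kap mu : E → ℝ≥0)
    (J : ℝ≥0 → Ω → E) (t : ℝ≥0) : Measure ℝ :=
  P.map (fun ω => randomParameter lam kap mu t (fun s => J s ω))

/-- The law of `M_n(t) / n`, where `M_n(t)` is the number of jobs at time `t` in the queue with
arrival rate `n * lam` and background process `J`. -/
def scaledJobsLaw {Ω E : Type*} [MeasurableSpace Ω] (P : Measure Ω) (lam kap mu : E → ℝ≥0)
    (J : ℝ≥0 → Ω → E) (σ Z : ℕ → Ω → ℝ) (t : ℝ≥0) (n : ℕ) : Measure ℝ :=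
  P.map (fun ω => (jobsInSystem (fun x => (n : ℝ≥0) * lam x) kap mu (fun s => J s ω)
    (fun k => σ k ω) (fun k => Z k ω) t : ℝ) / (n : ℝ))

end

end ModulatedQueue

/-!
Given the background path `f`, the arrival epochs on the unit-rate scale together with the
standardized service requirements form a Poisson process with independent marks, and a job is in
the system at time `t` exactly if its marked epoch lies in a set determined by `f`. Hence the number
of jobs is Poisson distributed, and the change of variables `u = ∫₀ˢ nλ(f)` identifies its mean as
`n φ_t(f)`. The law of `M_n / n` is therefore the mixture, over the law of `φ_t(J_n)`, of the laws
of scaled Poisson variables.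

For such a mixture the upper bound holds without goodness of `ψ`, because Chernoff's bound is
uniform in the parameter: cut the parameter space into finitely many layers according to the Poisson
cost of reaching the closed set `F`, with a mesh that tends to zero in the end. Each layer is
contained in a closed set, to which the LDP of the parameters applies. The lower bound needs
Stirling's formula, locally uniformly in the parameter. Finally, `ψ` is infinite outside the
attainable parameters, so that restricting the infimum to them changes nothing.
-/

namespace ModulatedQueue

/-! ### Large deviations of mixtures -/

section Mixture

open ExpGrowth

lemma ereal_exp_neg_mul_natCast (c : ℝ≥0) (n : ℕ) :
    EReal.exp (((-c : ℝ) : EReal) * n) = ENNReal.ofReal (Real.exp (-(c * n))) := by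
  rw [← EReal.coe_natCast, ← EReal.coe_mul, EReal.exp_coe, neg_mul]

lemma expGrowthInf_exp_neg_mul (c : ℝ≥0) :
    expGrowthInf (fun n : ℕ => ENNReal.ofReal (Real.exp (-(c * n)))) = ((-c : ℝ) : EReal) := by
  simp_rw [← ereal_exp_neg_mul_natCast, expGrowthInf_exp]

lemma expGrowthSup_exp_neg_mul (c : ℝ≥0) :
    expGrowthSup (fun n : ℕ => ENNReal.ofReal (Real.exp (-(c * n)))) = ((-c : ℝ) : EReal) := by
  simp_rw [← ereal_exp_neg_mul_natCast, expGrowthSup_exp]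

lemma expGrowthSup_exp_neg_mul_mul_le (c : ℝ≥0) (u : ℕ → ℝ≥0∞) :
    expGrowthSup (fun n => ENNReal.ofReal (Real.exp (-(c * n))) * u n) ≤
      ((-c : ℝ) : EReal) + expGrowthSup u := by
  rw [← expGrowthSup_exp_neg_mul]
  apply expGrowthSup_mul_le <;> rw [expGrowthSup_exp_neg_mul] <;> simp [-EReal.coe_neg]

lemma le_neg_coe_of_forall {S : EReal} {I : ℝ≥0∞}
    (h : ∀ m : ℝ≥0, m ≤ I → ∀ d : ℝ≥0, 0 < d → S ≤ ((d - m : ℝ) : EReal)) : S ≤ -(I : EReal) := by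
  refine EReal.le_of_forall_lt_iff_le.1 fun z hz => ?_
  obtain ⟨m, hm, hzm⟩ : ∃ m : ℝ≥0, m ≤ I ∧ -z < m := by
    induction I with
    | top => exact ⟨(-z).toNNReal + 1, le_top, (Real.le_coe_toNNReal _).trans_lt (by simp)⟩
    | coe I =>
      refine ⟨I, le_rfl, ?_⟩
      rw [EReal.coe_nnreal_eq_coe_real, ← EReal.coe_neg, EReal.coe_lt_coe_iff] at hz
      linarith
  have hd : 0 < z + m := by linarith
  convert! h m hm ⟨z + m, hd.le⟩ hd using 2
  exact (add_sub_cancel_right z (m : ℝ)).symm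

lemma neg_coe_le_of_forall {T : EReal} {I : ℝ≥0∞}
    (h : ∀ c : ℝ≥0, I < c → ((-c : ℝ) : EReal) ≤ T) : -(I : EReal) ≤ T := by
  refine EReal.ge_of_forall_gt_iff_ge.1 fun z hz => ?_
  have hI : (I : EReal) < ((-z : ℝ) : EReal) := by simpa using EReal.lt_neg_comm.1 hz
  have hz0 : 0 ≤ -z := by exact_mod_cast ((EReal.coe_ennreal_nonneg I).trans_lt hI).le
  lift -z to ℝ≥0 using hz0 with c hc
  rw [← EReal.coe_nnreal_eq_coe_real, EReal.coe_ennreal_lt_coe_ennreal_iff] at hI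
  simpa [hc] using h c hI

section Reaching

variable {X Y : Type*} {L : X → Y → ℝ≥0∞} {F : Set Y}

/-- The parameters from which some point of `F` is reached at cost at most `c`. -/
def reaching (L : X → Y → ℝ≥0∞) (F : Set Y) (c : ℝ≥0) : Set X :=
  {x | ∃ a ∈ F, L x a ≤ c}

lemma notMem_reaching {c : ℝ≥0} {x : X} :
    x ∉ reaching L F c ↔ ∀ a ∈ F, c < L x a := by
  simp [reaching]

lemma apply_le_sum_indicator {u : X → ℝ≥0∞} {C : ℝ≥0∞} (d : ℝ≥0) (hu : ∀ x, u x ≤ C)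
    {n : ℕ} (h : ∀ x (c : ℝ≥0), x ∉ reaching L F c → u x ≤ C * ENNReal.ofReal (Real.exp (-(c * n))))
    (k : ℕ) (x : X) :
    u x ≤ C * (∑ i ∈ Finset.range k, (reaching L F ((i + 1) * d)).indicator
      (fun _ => ENNReal.ofReal (Real.exp (-((i * d : ℝ≥0) * n)))) x +
        ENNReal.ofReal (Real.exp (-((k * d : ℝ≥0) * n)))) := by
  induction k with
  | zero => simpa using hu x
  | succ k ih =>
    by_cases hx : x ∈ reaching L F ((k + 1) * d)
    · refine ih.trans ?_
      rw [Finset.sum_range_succ, indicator_of_mem hx]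
      exact mul_le_mul_right le_self_add C
    · push_cast
      exact (h x _ hx).trans (mul_le_mul_right le_add_self C)

lemma layer_le {m i d : ℝ≥0} {J : ℝ≥0∞} (h : (m : ℝ≥0∞) ≤ ((i + 1) * d : ℝ≥0) + J) :
    ((-(i * d : ℝ≥0) : ℝ) : EReal) + -(J : EReal) ≤ ((d - m : ℝ) : EReal) := by
  induction J with
  | top => simp
  | coe J =>
    have h' : (m : ℝ) ≤ (i + 1) * d + J := by exact_mod_cast h
    rw [EReal.coe_nnreal_eq_coe_real, ← EReal.coe_neg, ← EReal.coe_add, EReal.coe_le_coe_iff]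
    push_cast
    linarith

end Reaching

variable {X Y : Type*} [TopologicalSpace X] [MeasurableSpace X] [TopologicalSpace Y]
  [MeasurableSpace Y]

lemma SatisfiesLDP.of_map_isClosedEmbedding [BorelSpace X] [BorelSpace Y]
    {ν : ℕ → Measure X} {ψ : Y → ℝ≥0∞} {f : X → Y} (hf : IsClosedEmbedding f)
    (h : SatisfiesLDP (fun n => (ν n).map f) ψ) : SatisfiesLDP ν (ψ ∘ f) where
  lowerSemicontinuous := h.lowerSemicontinuous.comp hf.continuous
  upper_bound F hF := by
    have hFc : IsClosed (f '' F) := hf.isClosedMap F hF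
    simpa only [Measure.map_apply hf.continuous.measurable hFc.measurableSet,
      preimage_image_eq F hf.injective, iInf_image, Function.comp_apply] using h.upper_bound _ hFc
  lower_bound G hG := by
    obtain ⟨V, hV, rfl⟩ := hf.isInducing.isOpen_iff.1 hG
    have hle : ⨅ y ∈ V, ψ y ≤ ⨅ x ∈ f ⁻¹' V, (ψ ∘ f) x := le_iInf₂ fun x hx => iInf₂_le (f x) hx
    have hlower := h.lower_bound V hV
    simp only [Measure.map_apply hf.continuous.measurable hV.measurableSet] at hlower
    exact (EReal.neg_le_neg_iff.2 (EReal.coe_ennreal_le_coe_ennreal_iff.2 hle)).trans hlower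

/-- A family of kernels that satisfies large deviations bounds with rate function `L x` at each
parameter `x`, with the upper bound uniform in `x` and the lower bound locally uniform in `x`. That
closed subsets of the sublevel sets of `L` have closed projections replaces the compactness of the
sublevel sets of the rate function of a random parameter. -/
structure UniformLDP (κ : ℕ → Kernel X Y) (L : X → Y → ℝ≥0∞) : Prop where
  lowerSemicontinuous : LowerSemicontinuous fun p : X × Y => L p.1 p.2
  isClosed_image_fst : ∀ (c : ℝ≥0) (S : Set (X × Y)), IsClosed S → (∀ p ∈ S, L p.1 p.2 ≤ c) →
    IsClosed (Prod.fst '' S)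
  isClosed_image_snd : ∀ (c : ℝ≥0) (S : Set (X × Y)), IsClosed S → (∀ p ∈ S, L p.1 p.2 ≤ c) →
    IsClosed (Prod.snd '' S)
  upper_bound : ∀ F : Set Y, IsClosed F → ∃ C : ℝ≥0, ∀ (n : ℕ) (x : X) (c : ℝ≥0),
    (∀ a ∈ F, c < L x a) → κ n x F ≤ C * ENNReal.ofReal (Real.exp (-(c * n)))
  lower_bound : ∀ G : Set Y, IsOpen G → ∀ (x : X), ∀ a ∈ G, ∀ c : ℝ≥0, L x a < c →
    ∀ᶠ p : ℕ × X in atTop ×ˢ 𝓝 x, ENNReal.ofReal (Real.exp (-(c * p.1))) ≤ κ p.1 p.2 G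

namespace UniformLDP

variable {κ : ℕ → Kernel X Y} {L : X → Y → ℝ≥0∞} {ν : ℕ → Measure X} {ψ : X → ℝ≥0∞}

lemma isClosed_reaching (hκ : UniformLDP κ L) {F : Set Y} (hF : IsClosed F) (c : ℝ≥0) :
    IsClosed (reaching L F c) := by
  have hS : IsClosed {p : X × Y | p.2 ∈ F ∧ L p.1 p.2 ≤ c} :=
    (hF.preimage continuous_snd).inter (hκ.lowerSemicontinuous.isClosed_preimage c)
  convert! hκ.isClosed_image_fst c _ hS fun p hp => hp.2 using 1
  ext x
  simp [reaching]

lemma lowerSemicontinuous_iInf_add (hκ : UniformLDP κ L) (hψ : LowerSemicontinuous ψ) :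
    LowerSemicontinuous fun a => ⨅ x, (L x a + ψ x) := by
  rw [lowerSemicontinuous_iff_isClosed_preimage]
  intro c
  have hset : (fun a => ⨅ x, (L x a + ψ x)) ⁻¹' Iic c =
      ⋂ (d : ℝ≥0) (_ : c < d), Prod.snd '' {p : X × Y | L p.1 p.2 + ψ p.1 ≤ d} := by
    ext a
    simp only [mem_preimage, mem_Iic, mem_iInter, mem_image, mem_ofPred_eq, Prod.exists,
      exists_eq_right]
    refine ⟨fun h d hd => ?_, fun h => le_of_forall_gt fun e he => ?_⟩
    · obtain ⟨x, hx⟩ := iInf_lt_iff.1 (h.trans_lt hd)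
      exact ⟨x, hx.le⟩
    · obtain ⟨d, hcd, hde⟩ := ENNReal.lt_iff_exists_nnreal_btwn.1 he
      obtain ⟨x, hx⟩ := h d hcd
      exact ((iInf_le _ x).trans hx).trans_lt hde
  rw [hset]
  have hlsc : LowerSemicontinuous fun p : X × Y => L p.1 p.2 + ψ p.1 :=
    hκ.lowerSemicontinuous.add (hψ.comp continuous_fst)
  exact isClosed_iInter fun d => isClosed_iInter fun _ =>
    hκ.isClosed_image_snd d _ (hlsc.isClosed_preimage d) fun p hp => le_self_add.trans hp

lemma lintegral_le_sum [OpensMeasurableSpace X] (hκ : UniformLDP κ L) [∀ n, IsMarkovKernel (κ n)]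
    [∀ n, IsProbabilityMeasure (ν n)] {F : Set Y} (hF : IsClosed F) (d : ℝ≥0) (k : ℕ) :
    ∃ C : ℝ≥0, ∀ n : ℕ, ∫⁻ x, κ n x F ∂ν n ≤
      C * (∑ i ∈ Finset.range k, ENNReal.ofReal (Real.exp (-((i * d : ℝ≥0) * n))) *
        ν n (reaching L F ((i + 1) * d)) + ENNReal.ofReal (Real.exp (-((k * d : ℝ≥0) * n)))) := by
  obtain ⟨C, hC⟩ := hκ.upper_bound F hF
  have hm (c : ℝ≥0) : MeasurableSet (reaching L F c) := (hκ.isClosed_reaching hF c).measurableSet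
  refine ⟨C + 1, fun n => ?_⟩
  calc ∫⁻ x, κ n x F ∂ν n
      ≤ ∫⁻ x, (C + 1 : ℝ≥0) * (∑ i ∈ Finset.range k, (reaching L F ((i + 1) * d)).indicator
          (fun _ => ENNReal.ofReal (Real.exp (-((i * d : ℝ≥0) * n)))) x +
            ENNReal.ofReal (Real.exp (-((k * d : ℝ≥0) * n)))) ∂ν n := by
        refine lintegral_mono (apply_le_sum_indicator d (fun x => prob_le_one.trans (by simp))
          (fun x c hx => (hC n x c (notMem_reaching.1 hx)).trans ?_) k)
        gcongr
        simp
    _ = _ := by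
        rw [lintegral_const_mul _ (by fun_prop (disch := exact hm _)),
          lintegral_add_right _ measurable_const,
          lintegral_finsetSum _ fun i _ => measurable_const.indicator (hm _)]
        simp [lintegral_indicator_const (hm _)]

lemma expGrowthSup_lintegral_le [OpensMeasurableSpace X] (hκ : UniformLDP κ L)
    [∀ n, IsMarkovKernel (κ n)] [∀ n, IsProbabilityMeasure (ν n)] (hν : SatisfiesLDP ν ψ)
    {F : Set Y} (hF : IsClosed F) {m d : ℝ≥0} (hm : m ≤ ⨅ a ∈ F, ⨅ x, (L x a + ψ x)) (hd : 0 < d) :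
    expGrowthSup (fun n => ∫⁻ x, κ n x F ∂ν n) ≤ ((d - m : ℝ) : EReal) := by
  have hlayer (i : ℕ) :
      (m : ℝ≥0∞) ≤ ((i + 1) * d : ℝ≥0) + ⨅ x ∈ reaching L F ((i + 1) * d), ψ x := by
    refine tsub_le_iff_left.1 (le_iInf₂ fun x ⟨a, ha, hxa⟩ => tsub_le_iff_left.2 ?_)
    exact (hm.trans ((iInf₂_le a ha).trans (iInf_le _ x))).trans (add_le_add_left hxa _)
  obtain ⟨k, hk⟩ := exists_nat_ge (m / d)
  obtain ⟨C, hC⟩ := hκ.lintegral_le_sum (ν := ν) hF d k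
  refine (expGrowthSup_le_of_eventually_le ENNReal.coe_ne_top (Eventually.of_forall hC)).trans ?_
  refine (expGrowthSup_add (u := fun n => ∑ i ∈ _, _)).le.trans (sup_le ?_ ?_)
  · rw [← Finset.sum_fn, expGrowthSup_sum]
    refine iSup₂_le fun i _ => (expGrowthSup_exp_neg_mul_mul_le _ _).trans ?_
    exact (add_le_add_right (hν.upper_bound _ (hκ.isClosed_reaching hF _)) _).trans
      (layer_le (hlayer i))
  · rw [expGrowthSup_exp_neg_mul, EReal.coe_le_coe_iff]
    have : (m : ℝ) ≤ k * d := by exact_mod_cast (div_le_iff₀ hd).1 hk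
    push_cast
    linarith [d.2]

lemma le_expGrowthInf_lintegral [OpensMeasurableSpace X] (hκ : UniformLDP κ L)
    (hν : SatisfiesLDP ν ψ) {G : Set Y} (hG : IsOpen G) {a : Y} (ha : a ∈ G) (x : X) {c : ℝ≥0}
    (hc : L x a < c) :
    ((-c : ℝ) : EReal) + -(ψ x : EReal) ≤ expGrowthInf (fun n => ∫⁻ x, κ n x G ∂ν n) := by
  obtain ⟨p, hp, q, hq, hpq⟩ := eventually_prod_iff.1 (hκ.lower_bound G hG x a ha c hc)
  obtain ⟨U, hUq, hU, hxU⟩ := eventually_nhds_iff.1 hq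
  calc ((-c : ℝ) : EReal) + -(ψ x : EReal)
      ≤ ((-c : ℝ) : EReal) + expGrowthInf (fun n => ν n U) := by
        refine add_le_add_right (le_trans ?_ (hν.lower_bound U hU)) _
        exact EReal.neg_le_neg_iff.2 (EReal.coe_ennreal_le_coe_ennreal_iff.2 (iInf₂_le x hxU))
    _ ≤ expGrowthInf (fun n => ENNReal.ofReal (Real.exp (-(c * n))) * ν n U) := by
        rw [← expGrowthInf_exp_neg_mul]
        exact le_expGrowthInf_mul
    _ ≤ expGrowthInf (fun n => ∫⁻ x, κ n x G ∂ν n) := by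
        refine expGrowthInf_eventually_monotone (hp.mono fun n hn => ?_)
        calc ENNReal.ofReal (Real.exp (-(c * n))) * ν n U
            = ∫⁻ _ in U, ENNReal.ofReal (Real.exp (-(c * n))) ∂ν n := by simp
          _ ≤ ∫⁻ x in U, κ n x G ∂ν n :=
              setLIntegral_mono' hU.measurableSet fun y hy => hpq hn (hUq y hy)
          _ ≤ ∫⁻ x, κ n x G ∂ν n := setLIntegral_le_lintegral U _

theorem satisfiesLDP_comp [OpensMeasurableSpace X] [OpensMeasurableSpace Y] (hκ : UniformLDP κ L)
    [∀ n, IsMarkovKernel (κ n)] [∀ n, IsProbabilityMeasure (ν n)] (hν : SatisfiesLDP ν ψ) :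
    SatisfiesLDP (fun n => κ n ∘ₘ ν n) (fun a => ⨅ x, (L x a + ψ x)) where
  lowerSemicontinuous := hκ.lowerSemicontinuous_iInf_add hν.lowerSemicontinuous
  upper_bound F hF := by
    simp only [Measure.bind_apply hF.measurableSet (Kernel.aemeasurable _)]
    change expGrowthSup _ ≤ _
    exact le_neg_coe_of_forall fun m hm d hd => hκ.expGrowthSup_lintegral_le hν hF hm hd
  lower_bound G hG := by
    simp only [Measure.bind_apply hG.measurableSet (Kernel.aemeasurable _)]
    change _ ≤ expGrowthInf _
    refine neg_coe_le_of_forall fun c hc => ?_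
    simp only [iInf_lt_iff] at hc
    obtain ⟨a, ha, x, hx⟩ := hc
    lift ψ x to ℝ≥0 using ne_top_of_lt (le_add_self.trans_lt hx) with r hr
    have hL : L x a < (c - r : ℝ≥0) := by
      rw [ENNReal.coe_sub]
      exact lt_tsub_iff_right.2 hx
    have hrc : r ≤ c := by exact_mod_cast (le_add_self.trans_lt hx).le
    have h := hκ.le_expGrowthInf_lintegral hν hG ha x hL
    rw [← hr, NNReal.coe_sub hrc, EReal.coe_nnreal_eq_coe_real, ← EReal.coe_neg, ← EReal.coe_add]
      at h
    convert! h using 2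
    ring

end UniformLDP

end Mixture

/-! ### The Poisson rate function -/

section PoissonRate

lemma hasSum_exp_mul_poisson (r : ℝ≥0) (θ : ℝ) :
    HasSum (fun k : ℕ => Real.exp (-r) * r ^ k / k.factorial * Real.exp (θ * k))
      (Real.exp (r * (Real.exp θ - 1))) := by
  have h := (NormedSpace.expSeries_div_hasSum_exp (r * Real.exp θ)).mul_left (Real.exp (-(r : ℝ)))
  rw [← Real.exp_eq_exp_ℝ, ← Real.exp_add] at h
  convert! h using 1
  · funext k
    rw [mul_pow, ← Real.exp_nat_mul, mul_comm θ]
    ring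
  · congr 1
    ring

lemma integrable_exp_mul_poissonMeasure (r : ℝ≥0) (θ : ℝ) :
    Integrable (fun k : ℕ => Real.exp (θ * k)) (poissonMeasure r) := by
  rw [integrable_poissonMeasure_iff]
  simpa [abs_of_pos (Real.exp_pos _)] using (hasSum_exp_mul_poisson r θ).summable

lemma mgf_poissonMeasure (r : ℝ≥0) (θ : ℝ) :
    mgf (fun k : ℕ => (k : ℝ)) (poissonMeasure r) θ = Real.exp (r * (Real.exp θ - 1)) :=
  (hasSum_integral_poissonMeasure (integrable_exp_mul_poissonMeasure r θ)).unique
    (by simpa using hasSum_exp_mul_poisson r θ)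

lemma cgf_poissonMeasure (r : ℝ≥0) (θ : ℝ) :
    cgf (fun k : ℕ => (k : ℝ)) (poissonMeasure r) θ = r * (Real.exp θ - 1) := by
  rw [cgf, mgf_poissonMeasure, Real.log_exp]

lemma poissonRate_eq (γ : ℝ≥0) (a : ℝ) :
    poissonRate γ a = ⨆ θ : ℝ, ENNReal.ofReal (θ * a - γ * (Real.exp θ - 1)) := by
  simp only [poissonRate, cgf_poissonMeasure]

lemma ofReal_le_poissonRate (γ : ℝ≥0) (a θ : ℝ) :
    ENNReal.ofReal (θ * a - γ * (Real.exp θ - 1)) ≤ poissonRate γ a := by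
  rw [poissonRate_eq]
  exact le_iSup (fun θ : ℝ => ENNReal.ofReal (θ * a - γ * (Real.exp θ - 1))) θ

lemma le_of_poissonRate_le {γ c : ℝ≥0} {a : ℝ} (h : poissonRate γ a ≤ c) (θ : ℝ) :
    θ * a - γ * (Real.exp θ - 1) ≤ c := by
  have hle := (ofReal_le_poissonRate γ a θ).trans h
  rw [← ENNReal.ofReal_coe_nnreal] at hle
  exact (ENNReal.ofReal_le_ofReal_iff c.2).1 hle

lemma exists_lt_of_lt_poissonRate {γ c : ℝ≥0} {a : ℝ} (h : c < poissonRate γ a) :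
    ∃ θ : ℝ, c < θ * a - γ * (Real.exp θ - 1) := by
  rw [poissonRate_eq] at h
  obtain ⟨θ, hθ⟩ := lt_iSup_iff.1 h
  rw [← ENNReal.ofReal_coe_nnreal] at hθ
  exact ⟨θ, (ENNReal.ofReal_lt_ofReal_iff'.1 hθ).1⟩

lemma lowerSemicontinuous_poissonRate :
    LowerSemicontinuous fun p : ℝ≥0 × ℝ => poissonRate p.1 p.2 := by
  simp_rw [poissonRate_eq]
  refine lowerSemicontinuous_iSup fun θ => Continuous.lowerSemicontinuous ?_
  exact ENNReal.continuous_ofReal.comp (by fun_prop)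

lemma nonneg_of_poissonRate_ne_top {γ : ℝ≥0} {a : ℝ} (h : poissonRate γ a ≠ ⊤) : 0 ≤ a := by
  by_contra! ha
  lift poissonRate γ a to ℝ≥0 using h with c hc
  have hle := le_of_poissonRate_le hc.ge ((c + 1) / a)
  rw [div_mul_cancel₀ _ ha.ne] at hle
  have hexp : Real.exp ((c + 1) / a) ≤ 1 :=
    Real.exp_le_one_iff.2 (div_nonpos_of_nonneg_of_nonpos (by positivity) ha.le)
  linarith [mul_nonneg γ.coe_nonneg (sub_nonneg.2 hexp)]

lemma eq_zero_of_poissonRate_zero_ne_top {a : ℝ} (h : poissonRate 0 a ≠ ⊤) : a = 0 := by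
  by_contra! ha
  lift poissonRate 0 a to ℝ≥0 using h with c hc
  have hle := le_of_poissonRate_le hc.ge ((c + 1) / a)
  rw [div_mul_cancel₀ _ ha, NNReal.coe_zero] at hle
  linarith

lemma snd_le_of_poissonRate_le {γ c : ℝ≥0} {a : ℝ} (h : poissonRate γ a ≤ c) :
    a ≤ c + 2 * γ := by
  have hle := le_of_poissonRate_le h 1
  have hexp : γ * Real.exp 1 ≤ γ * 3 :=
    mul_le_mul_of_nonneg_left (Real.exp_one_lt_d9.le.trans (by norm_num)) γ.2
  linarith

lemma fst_le_of_poissonRate_le {γ c : ℝ≥0} {a : ℝ} (h : poissonRate γ a ≤ c) :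
    γ ≤ 2 * (c + a) := by
  have hle := le_of_poissonRate_le h (-1)
  have hexp : γ * Real.exp (-1) ≤ γ * (1 / 2) :=
    mul_le_mul_of_nonneg_left (Real.exp_neg_one_lt_d9.le.trans (by norm_num)) γ.2
  linarith

lemma coe_le_poissonRate_zero (γ : ℝ≥0) : γ ≤ poissonRate γ 0 := by
  refine ENNReal.le_of_forall_nnreal_lt fun c hc => ?_
  have hlim : Tendsto (fun θ : ℝ => θ * 0 - γ * (Real.exp θ - 1)) atBot (𝓝 γ) := by
    simpa using ((Real.tendsto_exp_atBot.sub_const 1).const_mul (γ : ℝ)).neg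
  obtain ⟨θ, hθ⟩ := (hlim.eventually_const_lt (NNReal.coe_lt_coe.2 (by exact_mod_cast hc))).exists
  rw [← ENNReal.ofReal_coe_nnreal]
  exact (ENNReal.ofReal_le_ofReal hθ.le).trans (ofReal_le_poissonRate γ 0 θ)

open InformationTheory in
lemma ofReal_mul_klFun_le_poissonRate {γ : ℝ≥0} {a : ℝ} (hγ : 0 < γ) (ha : 0 < a) :
    ENNReal.ofReal (γ * klFun (a / γ)) ≤ poissonRate γ a := by
  have hγ' : (γ : ℝ) ≠ 0 := by positivity
  convert! ofReal_le_poissonRate γ a (Real.log (a / γ)) using 2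
  rw [Real.exp_log (by positivity), klFun_apply]
  field_simp [hγ']
  ring

end PoissonRate

/-! ### Large deviations of Poisson distributions -/

section PoissonKernel

lemma isClosed_image_fst_of_isCompact {X Y : Type*} [TopologicalSpace X] [TopologicalSpace Y]
    [T2Space X] [WeaklyLocallyCompactSpace X] {K : Set (X × Y)} (hK : IsClosed K)
    (h : ∀ C : Set X, IsCompact C → ∃ D : Set Y, IsCompact D ∧ ∀ p ∈ K, p.1 ∈ C → p.2 ∈ D) :
    IsClosed (Prod.fst '' K) := by
  have hproper : IsProperMap fun p : K => (p : X × Y).1 := by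
    refine isProperMap_iff_isCompact_preimage.2 ⟨by fun_prop, fun C hC => ?_⟩
    obtain ⟨D, hD, hCD⟩ := h C hC
    convert! hK.isClosedEmbedding_subtypeVal.isCompact_preimage (hC.prod hD) using 1
    ext p
    exact ⟨fun hp => ⟨hp, hCD p p.2 hp⟩, fun hp => hp.1⟩
  simpa [image_eq_range] using hproper.isClosedMap.isClosed_range

lemma poissonMeasure_setOf_ge_le {n : ℕ} {γ c : ℝ≥0} {b : ℝ} (hb : γ ≤ b)
    (h : c < poissonRate γ b) :
    poissonMeasure (n * γ) {k : ℕ | n * b ≤ k} ≤ ENNReal.ofReal (Real.exp (-(c * n))) := by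
  obtain ⟨θ, hθ⟩ := exists_lt_of_lt_poissonRate h
  have hθ0 : 0 ≤ θ := by
    by_contra! hneg
    nlinarith [c.2, γ.2, Real.add_one_le_exp θ]
  rw [← ofReal_measureReal]
  refine ENNReal.ofReal_le_ofReal ((measure_ge_le_exp_cgf (X := fun k : ℕ => (k : ℝ)) (n * b) hθ0
    (integrable_exp_mul_poissonMeasure _ θ)).trans (Real.exp_le_exp.2 ?_))
  rw [cgf_poissonMeasure, NNReal.coe_mul, NNReal.coe_natCast]
  linarith [mul_le_mul_of_nonneg_left hθ.le n.cast_nonneg]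

lemma poissonMeasure_setOf_le_le {n : ℕ} {γ c : ℝ≥0} {b : ℝ} (hb : b ≤ γ)
    (h : c < poissonRate γ b) :
    poissonMeasure (n * γ) {k : ℕ | k ≤ n * b} ≤ ENNReal.ofReal (Real.exp (-(c * n))) := by
  obtain ⟨θ, hθ⟩ := exists_lt_of_lt_poissonRate h
  have hθ0 : θ ≤ 0 := by
    by_contra! hneg
    nlinarith [c.2, γ.2, Real.add_one_le_exp θ]
  rw [← ofReal_measureReal]
  refine ENNReal.ofReal_le_ofReal ((measure_le_le_exp_cgf (X := fun k : ℕ => (k : ℝ)) (n * b) hθ0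
    (integrable_exp_mul_poissonMeasure _ θ)).trans (Real.exp_le_exp.2 ?_))
  rw [cgf_poissonMeasure, NNReal.coe_mul, NNReal.coe_natCast]
  linarith [mul_le_mul_of_nonneg_left hθ.le n.cast_nonneg]

lemma measurable_poissonMeasure : Measurable poissonMeasure := by
  refine Measure.measurable_of_measurable_coe _ fun s hs => ?_
  simp only [poissonMeasure, Measure.sum_apply _ hs, Measure.smul_apply]
  fun_prop

/-- The Markov kernel that maps `γ` to the law of `N / n`, where `N` has the Poisson distribution
with parameter `n * γ`. -/
noncomputable def poissonKernel (n : ℕ) : Kernel ℝ≥0 ℝ where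
  toFun γ := (poissonMeasure (n * γ)).map fun k : ℕ => (k : ℝ) / n
  measurable' := (Measure.measurable_map _ (measurable_of_countable _)).comp
    (measurable_poissonMeasure.comp (measurable_const_mul _))

lemma poissonKernel_apply (n : ℕ) (γ : ℝ≥0) {F : Set ℝ} (hF : MeasurableSet F) :
    poissonKernel n γ F = poissonMeasure (n * γ) {k : ℕ | (k : ℝ) / n ∈ F} :=
  Measure.map_apply (measurable_of_countable _) hF

instance (n : ℕ) : IsMarkovKernel (poissonKernel n) where
  isProbabilityMeasure _ :=
    Measure.isProbabilityMeasure_map (measurable_of_countable _).aemeasurable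

lemma poissonKernel_inter_Ici_le {n : ℕ} (hn : 0 < n) {γ c : ℝ≥0} {F : Set ℝ} (hF : IsClosed F)
    (h : ∀ a ∈ F, c < poissonRate γ a) :
    poissonKernel n γ (F ∩ Ici (γ : ℝ)) ≤ ENNReal.ofReal (Real.exp (-(c * n))) := by
  rcases (F ∩ Ici (γ : ℝ)).eq_empty_or_nonempty with hempty | hne
  · simp [hempty]
  have hclosed : IsClosed (F ∩ Ici (γ : ℝ)) := hF.inter isClosed_Ici
  have hbdd : BddBelow (F ∩ Ici (γ : ℝ)) := ⟨γ, fun y hy => hy.2⟩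
  have hmem := hclosed.csInf_mem hne hbdd
  rw [poissonKernel_apply n γ hclosed.measurableSet]
  refine (measure_mono fun k hk => ?_).trans (poissonMeasure_setOf_ge_le hmem.2 (h _ hmem.1))
  exact (le_div_iff₀' (Nat.cast_pos.2 hn)).1 (csInf_le hbdd hk)

lemma poissonKernel_inter_Iic_le {n : ℕ} (hn : 0 < n) {γ c : ℝ≥0} {F : Set ℝ} (hF : IsClosed F)
    (h : ∀ a ∈ F, c < poissonRate γ a) :
    poissonKernel n γ (F ∩ Iic (γ : ℝ)) ≤ ENNReal.ofReal (Real.exp (-(c * n))) := by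
  rcases (F ∩ Iic (γ : ℝ)).eq_empty_or_nonempty with hempty | hne
  · simp [hempty]
  have hclosed : IsClosed (F ∩ Iic (γ : ℝ)) := hF.inter isClosed_Iic
  have hbdd : BddAbove (F ∩ Iic (γ : ℝ)) := ⟨γ, fun y hy => hy.2⟩
  have hmem := hclosed.csSup_mem hne hbdd
  rw [poissonKernel_apply n γ hclosed.measurableSet]
  refine (measure_mono fun k hk => ?_).trans (poissonMeasure_setOf_le_le hmem.2 (h _ hmem.1))
  exact (div_le_iff₀' (Nat.cast_pos.2 hn)).1 (le_csSup hbdd hk)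

lemma poissonKernel_le (n : ℕ) {γ c : ℝ≥0} {F : Set ℝ} (hF : IsClosed F)
    (h : ∀ a ∈ F, c < poissonRate γ a) :
    poissonKernel n γ F ≤ 2 * ENNReal.ofReal (Real.exp (-(c * n))) := by
  rcases n.eq_zero_or_pos with rfl | hn
  · simpa using prob_le_one.trans one_le_two
  rw [two_mul]
  calc poissonKernel n γ F
      ≤ poissonKernel n γ (F ∩ Ici (γ : ℝ) ∪ F ∩ Iic (γ : ℝ)) := by
        rw [← inter_union_distrib_left, union_comm, Iic_union_Ici, inter_univ]
    _ ≤ _ := (measure_union_le _ _).trans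
        (add_le_add (poissonKernel_inter_Ici_le hn hF h) (poissonKernel_inter_Iic_le hn hF h))

lemma log_factorial_le {k : ℕ} (hk : 0 < k) :
    Real.log k.factorial ≤ 1 + Real.log k / 2 + k * Real.log k - k := by
  obtain ⟨m, rfl⟩ := Nat.exists_eq_succ_of_ne_zero hk.ne'
  have h := Stirling.stirlingSeq'_antitone (Nat.zero_le m)
  simp only [Function.comp_apply, Nat.succ_eq_add_one, zero_add, Stirling.stirlingSeq_one] at h ⊢
  have hlog := Real.log_le_log (Stirling.stirlingSeq'_pos m) h
  rw [Stirling.log_stirlingSeq_formula, Real.log_div (Real.exp_ne_zero 1) (by positivity),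
    Real.log_exp, Real.log_sqrt zero_le_two, Real.log_mul two_ne_zero (by positivity),
    Real.log_div (by positivity) (Real.exp_ne_zero 1), Real.log_exp] at hlog
  linarith

open InformationTheory in
lemma exp_le_poissonMeasure_singleton {r : ℝ≥0} (hr : 0 < r) {k : ℕ} (hk : 0 < k) :
    ENNReal.ofReal (Real.exp (-(r * klFun (k / r) + (1 + Real.log k / 2)))) ≤
      poissonMeasure r {k} := by
  have hr' : (0 : ℝ) < r := hr
  have hk' : (0 : ℝ) < k := by exact_mod_cast hk
  rw [poissonMeasure_singleton]
  refine ENNReal.ofReal_le_ofReal ?_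
  rw [← Real.le_log_iff_exp_le (by positivity), Real.log_div (by positivity) (by positivity),
    Real.log_mul (by positivity) (by positivity), Real.log_exp, Real.log_pow, klFun_apply,
    Real.log_div hk'.ne' hr'.ne']
  have hkl : r * (k / r * (Real.log k - Real.log r) + 1 - k / r) =
      k * (Real.log k - Real.log r) + r - k := by
    field_simp
  linarith [log_factorial_le hk]

lemma tendsto_floor_mul_div_natCast {a : ℝ} (ha : 0 ≤ a) :
    Tendsto (fun n : ℕ => (⌊a * n⌋₊ : ℝ) / n) atTop (𝓝 a) :=
  (tendsto_nat_floor_mul_div_atTop ha).comp tendsto_natCast_atTop_atTop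

lemma tendsto_log_floor_mul_div_natCast {a : ℝ} (ha : 0 < a) :
    Tendsto (fun n : ℕ => (1 + Real.log ⌊a * n⌋₊ / 2) / n) atTop (𝓝 0) := by
  have hfloor : Tendsto (fun n : ℕ => (⌊a * n⌋₊ : ℝ)) atTop atTop :=
    (tendsto_natCast_atTop_atTop.comp (tendsto_nat_floor_mul_atTop a ha)).comp
      tendsto_natCast_atTop_atTop
  have hlog : Tendsto (fun x : ℝ => Real.log x / x) atTop (𝓝 0) := by
    simpa using Real.tendsto_pow_log_div_mul_add_atTop 1 0 1 one_ne_zero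
  have hlim := (tendsto_const_div_atTop_nhds_zero_nat (1 : ℝ)).add
    (((hlog.comp hfloor).mul (tendsto_floor_mul_div_natCast ha.le)).div_const 2)
  simp only [zero_mul, zero_div, add_zero] at hlim
  refine hlim.congr' ?_
  filter_upwards [hfloor.eventually_ne_atTop 0] with n hn
  rw [Function.comp_apply, div_mul_div_cancel₀ hn]
  ring

open InformationTheory in
lemma eventually_exp_le_poissonMeasure_floor {γ c : ℝ≥0} (hγ : 0 < γ) {a : ℝ} (ha : 0 < a)
    (h : poissonRate γ a < c) :
    ∀ᶠ p : ℕ × ℝ≥0 in atTop ×ˢ 𝓝 γ,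
      ENNReal.ofReal (Real.exp (-(c * p.1))) ≤ poissonMeasure (p.1 * p.2) {⌊a * p.1⌋₊} := by
  have hγ' : (γ : ℝ) ≠ 0 := (NNReal.coe_pos.2 hγ).ne'
  have hrate : γ * klFun (a / γ) < c := by
    have := (ofReal_mul_klFun_le_poissonRate hγ ha).trans_lt h
    rw [← ENNReal.ofReal_coe_nnreal] at this
    exact (ENNReal.ofReal_lt_ofReal_iff'.1 this).1
  have hsnd : Tendsto (fun p : ℕ × ℝ≥0 => (p.2 : ℝ)) (atTop ×ˢ 𝓝 γ) (𝓝 γ) :=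
    (NNReal.continuous_coe.tendsto γ).comp tendsto_snd
  have hratio := (tendsto_floor_mul_div_natCast ha.le).comp (tendsto_fst (f := atTop) (g := 𝓝 γ))
  have hlim := (hsnd.mul ((continuous_klFun.tendsto _).comp (hratio.div hsnd hγ'))).add
    ((tendsto_log_floor_mul_div_natCast ha).comp tendsto_fst)
  rw [add_zero] at hlim
  filter_upwards [hlim.eventually_lt_const hrate, tendsto_snd.eventually (lt_mem_nhds hγ),
    hratio.eventually_const_lt ha, tendsto_fst.eventually (eventually_gt_atTop 0)]
    with ⟨n, g⟩ hlt hg hfloor hn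
  simp only [Function.comp_apply, Pi.div_apply] at hlt hg hfloor hn
  have hn' : (0 : ℝ) < n := by exact_mod_cast hn
  have hg' : (g : ℝ) ≠ 0 := by positivity
  have hk : 0 < ⌊a * n⌋₊ := by exact_mod_cast (div_pos_iff_of_pos_right hn').1 hfloor
  refine le_trans (ENNReal.ofReal_le_ofReal (Real.exp_le_exp.2 (neg_le_neg ?_)))
    (exp_le_poissonMeasure_singleton (r := n * g) (by positivity) hk)
  rw [NNReal.coe_mul, NNReal.coe_natCast, ← div_div]
  calc n * g * klFun (⌊a * n⌋₊ / n / g) + (1 + Real.log ⌊a * n⌋₊ / 2)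
      = (g * klFun (⌊a * n⌋₊ / n / g) + (1 + Real.log ⌊a * n⌋₊ / 2) / n) * n := by
        field_simp [hg']
    _ ≤ c * n := mul_le_mul_of_nonneg_right hlt.le hn'.le

lemma eventually_exp_le_poissonMeasure_zero {γ c : ℝ≥0} (h : poissonRate γ 0 < c) :
    ∀ᶠ p : ℕ × ℝ≥0 in atTop ×ˢ 𝓝 γ,
      ENNReal.ofReal (Real.exp (-(c * p.1))) ≤ poissonMeasure (p.1 * p.2) {0} := by
  have hγ : γ < c := by exact_mod_cast (coe_le_poissonRate_zero γ).trans_lt h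
  filter_upwards [tendsto_snd.eventually (gt_mem_nhds hγ)] with ⟨n, g⟩ hg
  rw [poissonMeasure_singleton]
  refine ENNReal.ofReal_le_ofReal ?_
  have hle : (n * g : ℝ) ≤ c * n := by
    rw [mul_comm]
    exact mul_le_mul_of_nonneg_right (NNReal.coe_le_coe.2 hg.le) n.cast_nonneg
  simpa using hle

lemma eventually_exp_le_poissonKernel {γ c : ℝ≥0} {G : Set ℝ} (hG : IsOpen G) {a : ℝ}
    (ha : a ∈ G) (h : poissonRate γ a < c) :
    ∀ᶠ p : ℕ × ℝ≥0 in atTop ×ˢ 𝓝 γ,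
      ENNReal.ofReal (Real.exp (-(c * p.1))) ≤ poissonKernel p.1 p.2 G := by
  simp only [poissonKernel_apply _ _ hG.measurableSet]
  rcases (nonneg_of_poissonRate_ne_top h.ne_top).eq_or_lt with rfl | hpos
  · filter_upwards [eventually_exp_le_poissonMeasure_zero h] with p hp
    exact hp.trans (measure_mono (by simpa using ha))
  · have hγ : 0 < γ := by
      refine pos_iff_ne_zero.2 fun h0 => hpos.ne' (eq_zero_of_poissonRate_zero_ne_top ?_)
      exact h0 ▸ h.ne_top
    filter_upwards [eventually_exp_le_poissonMeasure_floor hγ hpos h, tendsto_fst.eventually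
      ((tendsto_floor_mul_div_natCast hpos.le).eventually (hG.mem_nhds ha))] with p hp hmem
    exact hp.trans (measure_mono (singleton_subset_iff.2 hmem))

theorem uniformLDP_poissonKernel : UniformLDP poissonKernel poissonRate where
  lowerSemicontinuous := lowerSemicontinuous_poissonRate
  isClosed_image_fst c S hS hc := isClosed_image_fst_of_isCompact hS fun C hC => by
    obtain ⟨R, hR⟩ := hC.bddAbove
    refine ⟨Icc 0 (c + 2 * R), isCompact_Icc, fun p hp hpC => ⟨?_, ?_⟩⟩
    · exact nonneg_of_poissonRate_ne_top (ne_top_of_le_ne_top ENNReal.coe_ne_top (hc p hp))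
    · have hpR : (p.1 : ℝ) ≤ R := hR hpC
      linarith [snd_le_of_poissonRate_le (hc p hp)]
  isClosed_image_snd c S hS hc := by
    have hswap : Prod.snd '' S = Prod.fst '' (Prod.swap '' S) := by simp [image_image]
    rw [hswap, image_swap_eq_preimage_swap]
    refine isClosed_image_fst_of_isCompact (hS.preimage continuous_swap) fun C hC => ?_
    obtain ⟨R, hR⟩ := hC.bddAbove
    refine ⟨Icc 0 (2 * (c + R)).toNNReal, isCompact_Icc, fun p hp hpC => ⟨zero_le, ?_⟩⟩
    have hpR : p.1 ≤ R := hR hpC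
    refine NNReal.coe_le_coe.1 (le_trans ?_ (Real.le_coe_toNNReal _))
    linarith [fst_le_of_poissonRate_le (hc (p.2, p.1) hp)]
  upper_bound F hF := ⟨2, fun n _ _ h => poissonKernel_le n hF h⟩
  lower_bound G hG γ a ha c h := eventually_exp_le_poissonKernel hG ha h

end PoissonKernel

/-! ### Change of variables along a primitive -/

section Primitive

variable {w : ℝ → ℝ} {a b : ℝ}

lemma monotone_primitive (h0 : ∀ x, 0 ≤ w x) (hi : ∀ u v, IntervalIntegrable w volume u v)
    (a : ℝ) : Monotone fun s => ∫ r in a..s, w r := fun s s' hs => by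
  rw [← sub_nonneg, intervalIntegral.integral_interval_sub_left (hi a s') (hi a s)]
  exact intervalIntegral.integral_nonneg hs fun u _ => h0 u

lemma setLIntegral_Ioc_ofReal (h0 : ∀ x, 0 ≤ w x) (hi : IntervalIntegrable w volume a b)
    (hab : a ≤ b) :
    ∫⁻ s in Ioc a b, ENNReal.ofReal (w s) = ENNReal.ofReal (∫ r in a..b, w r) := by
  rw [intervalIntegral.integral_of_le hab, ofReal_integral_eq_lintegral_ofReal hi.1
    (Eventually.of_forall h0)]

lemma exists_preimage_Iic_inter_Ioc {Λ : ℝ → ℝ} (hmono : Monotone Λ) (hcont : Continuous Λ)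
    (hab : a ≤ b) {u : ℝ} (hu : Λ a ≤ u) :
    ∃ c ∈ Icc a b, Λ c = min u (Λ b) ∧ Λ ⁻¹' Iic u ∩ Ioc a b = Ioc a c := by
  obtain ⟨c, ⟨hc, hcu⟩, hmax⟩ := (isCompact_Icc.inter_right
    (isClosed_Iic.preimage hcont)).exists_isGreatest ⟨a, left_mem_Icc.2 hab, hu⟩
  refine ⟨c, hc, le_antisymm (le_min hcu (hmono hc.2)) ?_, ?_⟩
  · obtain ⟨c', hc', hΛ⟩ := intermediate_value_Icc hab hcont.continuousOn
      ⟨le_min hu (hmono hab), min_le_right u (Λ b)⟩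
    exact hΛ ▸ hmono (hmax ⟨hc', hΛ.trans_le (min_le_left _ _)⟩)
  · ext s
    exact ⟨fun ⟨h1, h2⟩ => ⟨h2.1, hmax ⟨Ioc_subset_Icc_self h2, h1⟩⟩,
      fun ⟨h1, h2⟩ => ⟨(hmono h2).trans hcu, h1, h2.trans hc.2⟩⟩

lemma map_primitive_withDensity (h0 : ∀ x, 0 ≤ w x)
    (hi : ∀ u v, IntervalIntegrable w volume u v) (hab : a ≤ b) :
    ((volume.restrict (Ioc a b)).withDensity (fun s => ENNReal.ofReal (w s))).map
      (fun s => ∫ r in a..s, w r) = volume.restrict (Ioc 0 (∫ r in a..b, w r)) := by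
  set Λ : ℝ → ℝ := fun s => ∫ r in a..s, w r
  have hmono : Monotone Λ := monotone_primitive h0 hi a
  have hcont : Continuous Λ := intervalIntegral.continuous_primitive hi a
  have hΛa : Λ a = 0 := intervalIntegral.integral_same
  have hfin : IsFiniteMeasure
      ((volume.restrict (Ioc a b)).withDensity (fun s => ENNReal.ofReal (w s))) := by
    refine isFiniteMeasure_withDensity ?_
    rw [setLIntegral_Ioc_ofReal h0 (hi a b) hab]
    exact ENNReal.ofReal_ne_top
  refine Measure.ext_of_Iic _ _ fun u => ?_
  have hpre : MeasurableSet (Λ ⁻¹' Iic u) := hcont.measurable measurableSet_Iic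
  have hlhs : ((volume.restrict (Ioc a b)).withDensity (fun s => ENNReal.ofReal (w s))).map Λ
      (Iic u) = ∫⁻ s in Λ ⁻¹' Iic u ∩ Ioc a b, ENNReal.ofReal (w s) := by
    rw [Measure.map_apply hcont.measurable measurableSet_Iic, withDensity_apply _ hpre,
      Measure.restrict_restrict hpre]
  have hrhs : volume.restrict (Ioc 0 (Λ b)) (Iic u) = ENNReal.ofReal (min u (Λ b)) := by
    rw [Measure.restrict_apply measurableSet_Iic, inter_comm, Ioc_inter_Iic, min_comm,
      Real.volume_Ioc, sub_zero]
  rw [hlhs, hrhs]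
  rcases lt_or_ge u 0 with hu | hu
  · have hempty : Λ ⁻¹' Iic u ∩ Ioc a b = ∅ := eq_empty_of_forall_notMem fun s hs =>
      (hs.1.trans_lt (hu.trans_eq hΛa.symm)).not_ge (hmono hs.2.1.le)
    rw [hempty, ENNReal.ofReal_of_nonpos ((min_le_left _ _).trans hu.le)]
    simp
  · obtain ⟨c, hc, hΛc, hset⟩ :=
      exists_preimage_Iic_inter_Ioc hmono hcont hab (hΛa.trans_le hu)
    rw [hset, setLIntegral_Ioc_ofReal h0 (hi a c) hc.1, ← hΛc]

lemma lintegral_comp_primitive (hw : Measurable w) (h0 : ∀ x, 0 ≤ w x)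
    (hi : ∀ u v, IntervalIntegrable w volume u v) (hab : a ≤ b) {g : ℝ → ℝ≥0∞}
    (hg : Measurable g) :
    ∫⁻ s in Ioc a b, ENNReal.ofReal (w s) * g (∫ r in a..s, w r) =
      ∫⁻ y in Ioc 0 (∫ r in a..b, w r), g y := by
  have hc := (intervalIntegral.continuous_primitive hi a).measurable
  rw [← map_primitive_withDensity h0 hi hab, lintegral_map hg hc]
  exact (lintegral_withDensity_eq_lintegral_mul _ (by fun_prop) (hg.comp hc)).symm

lemma integral_comp_primitive (hw : Measurable w) (h0 : ∀ x, 0 ≤ w x)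
    (hi : ∀ u v, IntervalIntegrable w volume u v) (hab : a ≤ b) {g : ℝ → ℝ} (hg : Measurable g) :
    ∫ s in a..b, w s * g (∫ r in a..s, w r) = ∫ y in (0 : ℝ)..∫ r in a..b, w r, g y := by
  have hc := (intervalIntegral.continuous_primitive hi a).measurable
  rw [intervalIntegral.integral_of_le (intervalIntegral.integral_nonneg hab fun u _ => h0 u),
    ← map_primitive_withDensity h0 hi hab, integral_map hc.aemeasurable hg.aestronglyMeasurable,
    integral_withDensity_eq_integral_toReal_smul (by fun_prop)
      (Eventually.of_forall fun _ => ENNReal.ofReal_lt_top), intervalIntegral.integral_of_le hab]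
  simp only [ENNReal.toReal_ofReal (h0 _), smul_eq_mul]

-- A point where the primitive is flat to the left has the same image as a rational number, and
-- the countable set of these images is null for the image measure, which is Lebesgue measure.
lemma ae_primitive_lt (hw : Measurable w) (h0 : ∀ x, 0 ≤ w x)
    (hi : ∀ u v, IntervalIntegrable w volume u v) (hab : a ≤ b) :
    ∀ᵐ s ∂(volume.restrict (Ioc a b)), w s ≠ 0 →
      ∀ s' < s, ∫ r in a..s', w r < ∫ r in a..s, w r := by
  set Λ : ℝ → ℝ := fun s => ∫ r in a..s, w r
  have hmono : Monotone Λ := monotone_primitive h0 hi a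
  have hmeas : Measurable Λ := (intervalIntegral.continuous_primitive hi a).measurable
  have hcount : (range (fun q : ℚ => Λ q)).Countable := countable_range _
  have hnull : ((volume.restrict (Ioc a b)).withDensity (fun s => ENNReal.ofReal (w s)))
      (Λ ⁻¹' range (fun q : ℚ => Λ q)) = 0 := by
    rw [← Measure.map_apply hmeas hcount.measurableSet, map_primitive_withDensity h0 hi hab]
    exact hcount.measure_zero _
  have hae := (ae_withDensity_iff (μ := volume.restrict (Ioc a b)) (by fun_prop)).1
    (measure_eq_zero_iff_ae_notMem.1 hnull)
  filter_upwards [hae] with s hs hws s' hs'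
  have hnot := hs (ENNReal.ofReal_ne_zero_iff.2 ((h0 s).lt_of_ne' hws))
  refine (hmono hs'.le).lt_of_ne fun heq => hnot ?_
  obtain ⟨q, hq, hq'⟩ := exists_rat_btwn hs'
  exact ⟨q, le_antisymm (hmono hq'.le) (heq.symm.le.trans (hmono hq.le))⟩

end Primitive

/-! ### Sequences of independent marked exponential variables -/

section Sequences

lemma map_infinitePi_zero_succ {X : Type*} [MeasurableSpace X] (μ : Measure X)
    [IsProbabilityMeasure μ] :
    (Measure.infinitePi fun _ : ℕ => μ).map (fun ζ => (ζ 0, fun k => ζ (k + 1))) =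
      μ.prod (Measure.infinitePi fun _ => μ) := by
  have hindep : iIndepFun (fun (k : ℕ) (ζ : ℕ → X) => ζ k) (Measure.infinitePi fun _ => μ) :=
    iIndepFun_infinitePi fun _ => measurable_id
  have htail : IndepFun (fun ζ : ℕ → X => ζ 0) (fun ζ k => ζ (k + 1))
      (Measure.infinitePi fun _ => μ) := by
    have hdisj := indep_iSup_of_disjoint (fun k => (measurable_pi_apply k).comap_le)
      hindep.iIndep (S := {0}) (T := {0}ᶜ) disjoint_compl_right
    refine indep_of_indep_of_le_left (indep_of_indep_of_le_right hdisj ?_) ?_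
    · rw [MeasurableSpace.pi, MeasurableSpace.comap_iSup]
      exact iSup_le fun k => MeasurableSpace.comap_comp.trans_le <|
        le_iSup₂_of_le (k + 1) (Nat.succ_ne_zero k) le_rfl
    · exact le_iSup₂_of_le 0 rfl le_rfl
  rw [htail.map_prod_eq_prod_map_map (measurable_pi_apply 0).aemeasurable
    (by fun_prop : Measurable fun ζ : ℕ → X => fun k => ζ (k + 1)).aemeasurable,
    Measure.infinitePi_map_eval, Measure.map_infinitePi_infinitePi_of_inj Nat.succ_injective]

lemma ae_infinitePi_exists_mem {X : Type*} [MeasurableSpace X] {μ : Measure X}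
    [IsProbabilityMeasure μ] {A : Set X} (hA : MeasurableSet A) (h : μ A ≠ 0) :
    ∀ᵐ ζ ∂(Measure.infinitePi fun _ : ℕ => μ), ∃ k, ζ k ∈ A := by
  have hlt : μ Aᶜ < 1 := by
    rw [prob_compl_eq_one_sub hA]
    exact ENNReal.sub_lt_self ENNReal.one_ne_top one_ne_zero h
  have hle (n : ℕ) : Measure.infinitePi (fun _ : ℕ => μ) {ζ | ¬ ∃ k, ζ k ∈ A} ≤ μ Aᶜ ^ n := by
    rw [← Finset.card_range n, ← Finset.prod_const,
      ← Measure.infinitePi_pi (fun _ : ℕ => μ) fun _ _ => hA.compl]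
    exact measure_mono fun ζ hζ k _ => not_exists.1 hζ k
  exact ae_iff.2 <| le_antisymm
    (ge_of_tendsto' (ENNReal.tendsto_pow_atTop_nhds_zero_of_lt_one hlt) hle) zero_le

instance : IsProbabilityMeasure (expMeasure 1) := isProbabilityMeasure_expMeasure one_pos

lemma lintegral_add_expMeasure_one {g : ℝ → ℝ≥0∞} (hg : Measurable g) (u : ℝ) :
    ∫⁻ x, g (u + x) ∂(expMeasure 1) =
      ∫⁻ s in Ioi u, ENNReal.ofReal (Real.exp (-(s - u))) * g s := by
  have hpdf : Measurable (exponentialPDF 1) := (measurable_exponentialPDFReal 1).ennreal_ofReal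
  calc ∫⁻ x, g (u + x) ∂(expMeasure 1)
      = ∫⁻ x, exponentialPDF 1 x * g (u + x) :=
        lintegral_withDensity_eq_lintegral_mul _ hpdf (hg.comp (by fun_prop))
    _ = ∫⁻ x, exponentialPDF 1 (u + x - u) * g (u + x) := by simp only [add_sub_cancel_left]
    _ = ∫⁻ s, exponentialPDF 1 (s - u) * g s :=
        lintegral_add_left_eq_self (μ := volume) (fun s => exponentialPDF 1 (s - u) * g s) u
    _ = ∫⁻ s in Ici u, ENNReal.ofReal (Real.exp (-(s - u))) * g s := by
        rw [← lintegral_indicator measurableSet_Ici]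
        refine lintegral_congr fun s => ?_
        simp only [exponentialPDF_eq, indicator, mem_Ici, sub_nonneg, one_mul]
        split_ifs <;> simp
    _ = ∫⁻ s in Ioi u, ENNReal.ofReal (Real.exp (-(s - u))) * g s :=
        (setLIntegral_congr Ioi_ae_eq_Ici).symm

lemma expMeasure_one_Ioi {x : ℝ} (hx : 0 ≤ x) :
    expMeasure 1 (Ioi x) = ENNReal.ofReal (Real.exp (-x)) := by
  rw [← compl_Iic, ← ofReal_measureReal, probReal_compl_eq_one_sub measurableSet_Iic,
    ← cdf_eq_real, cdf_expMeasure_eq one_pos, if_pos hx, one_mul, sub_sub_cancel]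

variable {S : Type*} [MeasurableSpace S]

/-- The law of a sequence of independent pairs of a standard exponential variable and a mark with
law `ρ`: the interarrival times and the marks of a marked unit-rate Poisson process. -/
noncomputable def markedExpSeq (ρ : Measure S) : Measure (ℕ → ℝ × S) :=
  Measure.infinitePi fun _ => (expMeasure 1).prod ρ

variable {ρ : Measure S} [IsProbabilityMeasure ρ]

instance : IsProbabilityMeasure (markedExpSeq ρ) := by
  unfold markedExpSeq; infer_instance

lemma map_markedExpSeq_zero_succ :
    (markedExpSeq ρ).map (fun ζ => (ζ 0, fun k => ζ (k + 1))) =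
      ((expMeasure 1).prod ρ).prod (markedExpSeq ρ) :=
  map_infinitePi_zero_succ _

lemma ae_markedExpSeq_nonneg : ∀ᵐ ζ ∂markedExpSeq ρ, ∀ k, 0 ≤ (ζ k).1 := by
  have hexp : ∀ᵐ x ∂expMeasure 1, x ∈ Ioi (0 : ℝ) := by
    refine (mem_ae_iff_prob_eq_one measurableSet_Ioi).2 ?_
    rw [expMeasure_one_Ioi le_rfl]
    simp
  refine ae_all_iff.2 fun k => ?_
  have hfst : MeasurePreserving (fun ζ : ℕ → ℝ × S => (ζ k).1) (markedExpSeq ρ) (expMeasure 1) :=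
    measurePreserving_fst.comp (measurePreserving_eval_infinitePi _ k)
  exact (hfst.quasiMeasurePreserving.ae hexp).mono fun _ hx => (mem_Ioi.1 hx).le

lemma ae_markedExpSeq_exists_lt (L : ℝ) : ∀ᵐ ζ ∂markedExpSeq ρ, ∃ k, L < (ζ k).1 := by
  have hpos : (expMeasure 1).prod ρ (Ioi (max L 0) ×ˢ univ) ≠ 0 := by
    rw [Measure.prod_prod, measure_univ, mul_one, expMeasure_one_Ioi (le_max_right L 0)]
    exact (ENNReal.ofReal_pos.2 (Real.exp_pos _)).ne'
  filter_upwards [ae_infinitePi_exists_mem (measurableSet_Ioi.prod .univ) hpos] with ζ ⟨k, hk⟩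
  exact ⟨k, (le_max_left L 0).trans_lt hk.1⟩

end Sequences

/-! ### Marked Poisson processes -/

section MarkedPoisson

variable {S : Type*}

/-- The `k`-th renewal epoch of the sequence `ζ` of interarrival times and marks. -/
noncomputable def epoch (ζ : ℕ → ℝ × S) (k : ℕ) : ℝ := ∑ i ∈ Finset.range (k + 1), (ζ i).1

lemma epoch_zero (ζ : ℕ → ℝ × S) : epoch ζ 0 = (ζ 0).1 := by simp [epoch]

lemma epoch_succ (ζ : ℕ → ℝ × S) (k : ℕ) :
    epoch ζ (k + 1) = (ζ 0).1 + epoch (fun k => ζ (k + 1)) k := by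
  rw [epoch, Finset.sum_range_succ', add_comm, epoch]

lemma monotone_epoch {ζ : ℕ → ℝ × S} (hζ : ∀ k, 0 ≤ (ζ k).1) : Monotone (epoch ζ) :=
  monotone_nat_of_le_succ fun n => by
    simpa only [epoch, Finset.sum_range_succ _ (n + 1)] using le_add_of_nonneg_right (hζ (n + 1))

/-- The weight of the marked renewal path started at time `u` if it has exactly `n` points up to
time `L`, and zero otherwise. The weight is the product of the weights `W (s, b)` of these points
`s` with their marks `b`. -/
noncomputable def pathWeight (W : ℝ × S → ℝ≥0∞) (L : ℝ) (n : ℕ) (u : ℝ) (ζ : ℕ → ℝ × S) : ℝ≥0∞ :=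
  (∏ k ∈ Finset.range n, if u + epoch ζ k ≤ L then W (u + epoch ζ k, (ζ k).2) else 0) *
    if L < u + epoch ζ n then 1 else 0

/-- The number of points up to time `L` that belong with their marks to `B`, for the marked renewal
path started at time `0`. -/
noncomputable def markedCount (B : Set (ℝ × S)) (L : ℝ) (ζ : ℕ → ℝ × S) : ℕ :=
  {k | epoch ζ k ≤ L ∧ (epoch ζ k, (ζ k).2) ∈ B}.ncard

variable {W : ℝ × S → ℝ≥0∞} {w : ℝ → ℝ} {L : ℝ} {B : Set (ℝ × S)}

lemma pathWeight_zero (u : ℝ) (ζ : ℕ → ℝ × S) :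
    pathWeight W L 0 u ζ = if L < u + (ζ 0).1 then 1 else 0 := by
  simp [pathWeight, epoch_zero]

lemma pathWeight_succ (n : ℕ) (u : ℝ) (ζ : ℕ → ℝ × S) :
    pathWeight W L (n + 1) u ζ =
      (if u + (ζ 0).1 ≤ L then W (u + (ζ 0).1, (ζ 0).2) else 0) *
        pathWeight W L n (u + (ζ 0).1) fun k => ζ (k + 1) := by
  simp only [pathWeight, Finset.prod_range_succ', epoch_succ, epoch_zero, ← add_assoc]
  ring

open scoped Classical in
lemma tsum_pathWeight_eq_pow {ζ : ℕ → ℝ × S} (hζ : ∀ k, 0 ≤ (ζ k).1)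
    (hL : ∃ k, L < (ζ k).1) (s : ℝ≥0∞) :
    ∑' n, pathWeight (fun p => if p ∈ B then s else 1) L n 0 ζ = s ^ markedCount B L ζ := by
  have hex : ∃ n, L < epoch ζ n := hL.imp fun k hk => hk.trans_le <|
    Finset.single_le_sum (f := fun i => (ζ i).1) (fun i _ => hζ i) (Finset.self_mem_range_succ k)
  set N := Nat.find hex
  have hlt_iff (k : ℕ) : L < epoch ζ k ↔ N ≤ k :=
    ⟨Nat.find_min' hex, fun h => (Nat.find_spec hex).trans_le (monotone_epoch hζ h)⟩
  have hle_iff (k : ℕ) : epoch ζ k ≤ L ↔ k < N := by rw [← not_lt, hlt_iff, not_le]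
  simp only [pathWeight, markedCount, zero_add, hlt_iff, hle_iff]
  rw [tsum_eq_single N]
  · have hset : {k | k < N ∧ (epoch ζ k, (ζ k).2) ∈ B} =
        {k ∈ Finset.range N | (epoch ζ k, (ζ k).2) ∈ B} := by ext; simp
    rw [if_pos le_rfl, mul_one, hset, ncard_coe_finset, ← Finset.prod_const, Finset.prod_filter]
    exact Finset.prod_congr rfl fun k hk => if_pos (Finset.mem_range.1 hk)
  · intro n hn
    rcases hn.lt_or_gt with hlt | hgt
    · rw [if_neg hlt.not_ge, mul_zero]
    · rw [Finset.prod_eq_zero (Finset.mem_range.2 hgt) (if_neg (lt_irrefl N)), zero_mul]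

variable [MeasurableSpace S] {ρ : Measure S}

@[fun_prop]
lemma measurable_epoch (k : ℕ) : Measurable fun ζ : ℕ → ℝ × S => epoch ζ k := by
  unfold epoch; fun_prop

@[fun_prop]
lemma measurable_pathWeight (hW : Measurable W) (L : ℝ) (n : ℕ) :
    Measurable fun p : ℝ × (ℕ → ℝ × S) => pathWeight W L n p.1 p.2 := by
  refine Measurable.mul (Finset.measurable_fun_prod _ fun k _ => ?_) ?_
  · exact Measurable.ite (measurableSet_le (by fun_prop) measurable_const) (by fun_prop)
      measurable_const
  · exact Measurable.ite (measurableSet_lt measurable_const (by fun_prop)) measurable_const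
      measurable_const

lemma measurable_markedCount {X : Type*} [MeasurableSpace X] {B : X → Set (ℝ × S)} {L : X → ℝ}
    {ζ : X → ℕ → ℝ × S} (hB : MeasurableSet {q : X × ℝ × S | q.2 ∈ B q.1}) (hL : Measurable L)
    (hζ : Measurable ζ) : Measurable fun x => markedCount (B x) (L x) (ζ x) := by
  have hepoch (k : ℕ) : Measurable fun x => epoch (ζ x) k := (measurable_epoch k).comp hζ
  refine measurable_ncard.comp (measurable_set_iff.2 fun k => Measurable.and ?_ ?_)
  · exact measurableSet_setOfPred.1 (measurableSet_le (hepoch k) hL)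
  · exact hB.mem.comp (measurable_id.prodMk ((hepoch k).prodMk (by fun_prop)))

/-- The probability that a mark with law `ρ` puts the point `u` in `B`: the intensity, with respect
to Lebesgue measure, of the points of the marked Poisson process that belong to `B`. -/
noncomputable def markProb (ρ : Measure S) (B : Set (ℝ × S)) (u : ℝ) : ℝ :=
  ρ.real (Prod.mk u ⁻¹' B)

lemma markProb_nonneg (u : ℝ) : 0 ≤ markProb ρ B u := measureReal_nonneg

variable [IsProbabilityMeasure ρ]

lemma lintegral_pathWeight_zero {u : ℝ} (hu : u ≤ L) :
    ∫⁻ ζ, pathWeight W L 0 u ζ ∂markedExpSeq ρ = ENNReal.ofReal (Real.exp (-(L - u))) := by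
  have hfst : MeasurePreserving (fun ζ : ℕ → ℝ × S => (ζ 0).1) (markedExpSeq ρ) (expMeasure 1) :=
    measurePreserving_fst.comp (measurePreserving_eval_infinitePi _ 0)
  have hind (ζ : ℕ → ℝ × S) :
      pathWeight W L 0 u ζ = (Ioi (L - u)).indicator (fun _ => 1) (ζ 0).1 := by
    simp only [pathWeight_zero, indicator, mem_Ioi, sub_lt_iff_lt_add']
  simp only [hind]
  rw [hfst.lintegral_comp (measurable_const.indicator measurableSet_Ioi),
    lintegral_indicator_const measurableSet_Ioi, one_mul, expMeasure_one_Ioi (sub_nonneg.2 hu)]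

lemma lintegral_pathWeight_succ (hW : Measurable W) (n : ℕ) (u : ℝ) :
    ∫⁻ ζ, pathWeight W L (n + 1) u ζ ∂markedExpSeq ρ =
      ∫⁻ s in Ioc u L, ENNReal.ofReal (Real.exp (-(s - u))) *
        ((∫⁻ b, W (s, b) ∂ρ) * ∫⁻ ζ, pathWeight W L n s ζ ∂markedExpSeq ρ) := by
  have hmean : Measurable fun s => ∫⁻ b, W (s, b) ∂ρ := hW.lintegral_prod_right'
  have hpath : Measurable fun s => ∫⁻ ζ, pathWeight W L n s ζ ∂markedExpSeq ρ :=
    (measurable_pathWeight hW L n).lintegral_prod_right'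
  have hweight : Measurable fun p : ℝ × S => if u + p.1 ≤ L then W (u + p.1, p.2) else 0 :=
    Measurable.ite (measurableSet_le (by fun_prop) measurable_const) (by fun_prop) measurable_const
  have hprod : Measurable fun q : (ℝ × S) × (ℕ → ℝ × S) =>
      (if u + q.1.1 ≤ L then W (u + q.1.1, q.1.2) else 0) * pathWeight W L n (u + q.1.1) q.2 :=
    (hweight.comp measurable_fst).mul (by fun_prop)
  calc ∫⁻ ζ, pathWeight W L (n + 1) u ζ ∂markedExpSeq ρ
      = ∫⁻ q, (if u + q.1.1 ≤ L then W (u + q.1.1, q.1.2) else 0) *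
          pathWeight W L n (u + q.1.1) q.2 ∂((expMeasure 1).prod ρ).prod (markedExpSeq ρ) := by
        simp only [pathWeight_succ]
        rw [← map_markedExpSeq_zero_succ, lintegral_map hprod (by fun_prop)]
    _ = ∫⁻ x, ∫⁻ b, ∫⁻ ζ, (if u + x ≤ L then W (u + x, b) else 0) *
          pathWeight W L n (u + x) ζ ∂markedExpSeq ρ ∂ρ ∂expMeasure 1 := by
        rw [lintegral_prod _ hprod.aemeasurable, lintegral_prod]
        exact hprod.lintegral_prod_right'.aemeasurable
    _ = ∫⁻ x, (Iic L).indicator (fun s => (∫⁻ b, W (s, b) ∂ρ) *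
          ∫⁻ ζ, pathWeight W L n s ζ ∂markedExpSeq ρ) (u + x) ∂expMeasure 1 := by
        refine lintegral_congr fun x => ?_
        simp only [indicator, mem_Iic]
        split_ifs
        · rw [← lintegral_mul_const _ (by fun_prop)]
          exact lintegral_congr fun b => lintegral_const_mul _ (by fun_prop)
        · simp
    _ = _ := by
        rw [lintegral_add_expMeasure_one (Measurable.indicator (by fun_prop) measurableSet_Iic),
          ← Ioi_inter_Iic, inter_comm, ← setLIntegral_indicator measurableSet_Iic]
        exact lintegral_congr fun s =>
          (indicator_mul_right _ (fun s => ENNReal.ofReal (Real.exp (-(s - u)))) _).symm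

lemma setLIntegral_sub_pow {c : ℝ} (hc : 0 ≤ c) (n : ℕ) :
    ∫⁻ y in Ioc 0 c, ENNReal.ofReal ((c - y) ^ n / n.factorial) =
      ENNReal.ofReal (c ^ (n + 1) / (n + 1).factorial) := by
  have hcont : Continuous (fun y : ℝ => (c - y) ^ n / n.factorial) := by fun_prop
  have hnonneg : 0 ≤ᵐ[volume.restrict (Ioc 0 c)] fun y => (c - y) ^ n / n.factorial :=
    (ae_restrict_mem measurableSet_Ioc).mono fun y hy =>
      div_nonneg (pow_nonneg (sub_nonneg.2 hy.2) n) (Nat.cast_nonneg _)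
  rw [← ofReal_integral_eq_lintegral_ofReal (hcont.intervalIntegrable 0 c).1 hnonneg,
    ← intervalIntegral.integral_of_le hc, intervalIntegral.integral_div,
    intervalIntegral.integral_comp_sub_left (fun y => y ^ n) c, integral_pow, Nat.factorial_succ]
  congr 1
  rw [sub_self, sub_zero, zero_pow n.succ_ne_zero, sub_zero]
  push_cast
  field_simp

lemma lintegral_pathWeight (hW : Measurable W) (hw : Measurable w) (h0 : ∀ u, 0 ≤ w u)
    (hi : ∀ u v, IntervalIntegrable w volume u v)
    (hmean : ∀ u, ∫⁻ b, W (u, b) ∂ρ = ENNReal.ofReal (w u)) (n : ℕ) {u : ℝ} (hu : u ≤ L) :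
    ∫⁻ ζ, pathWeight W L n u ζ ∂markedExpSeq ρ =
      ENNReal.ofReal (Real.exp (-(L - u)) * ((∫ r in u..L, w r) ^ n / n.factorial)) := by
  induction n generalizing u with
  | zero => simp [lintegral_pathWeight_zero hu]
  | succ n ih =>
    have hintegrand : ∀ s ∈ Ioc u L, ENNReal.ofReal (Real.exp (-(s - u))) *
        ((∫⁻ b, W (s, b) ∂ρ) * ∫⁻ ζ, pathWeight W L n s ζ ∂markedExpSeq ρ) =
        ENNReal.ofReal (Real.exp (-(L - u))) * (ENNReal.ofReal (w s) *
          ENNReal.ofReal (((∫ r in u..L, w r) - ∫ r in u..s, w r) ^ n / n.factorial)) := by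
      intro s hs
      rw [hmean, ih hs.2, intervalIntegral.integral_interval_sub_left (hi u L) (hi u s),
        show -(L - u) = -(s - u) + -(L - s) by ring, Real.exp_add,
        ENNReal.ofReal_mul (Real.exp_nonneg _), ENNReal.ofReal_mul (Real.exp_nonneg _)]
      ring
    have hprim := (intervalIntegral.continuous_primitive hi u).measurable
    rw [lintegral_pathWeight_succ hW, setLIntegral_congr_fun measurableSet_Ioc hintegrand,
      lintegral_const_mul _ (by fun_prop), lintegral_comp_primitive hw h0 hi hu
        (g := fun y => ENNReal.ofReal (((∫ r in u..L, w r) - y) ^ n / n.factorial)) (by fun_prop),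
      setLIntegral_sub_pow (intervalIntegral.integral_nonneg hu fun r _ => h0 r),
      ← ENNReal.ofReal_mul (Real.exp_nonneg _)]

lemma lintegral_tsum_pathWeight (hW : Measurable W) (hw : Measurable w) (h0 : ∀ u, 0 ≤ w u)
    (hi : ∀ u v, IntervalIntegrable w volume u v)
    (hmean : ∀ u, ∫⁻ b, W (u, b) ∂ρ = ENNReal.ofReal (w u)) (hL : 0 ≤ L) :
    ∫⁻ ζ, ∑' n, pathWeight W L n 0 ζ ∂markedExpSeq ρ =
      ENNReal.ofReal (Real.exp ((∫ u in (0 : ℝ)..L, w u) - L)) := by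
  have hpos : 0 ≤ ∫ u in (0 : ℝ)..L, w u := intervalIntegral.integral_nonneg hL fun u _ => h0 u
  have hexp := (NormedSpace.expSeries_div_hasSum_exp (∫ u in (0 : ℝ)..L, w u)).mul_left
    (Real.exp (-(L - 0)))
  rw [← Real.exp_eq_exp_ℝ, ← Real.exp_add, sub_zero, neg_add_eq_sub] at hexp
  rw [lintegral_tsum fun n => by fun_prop]
  simp only [lintegral_pathWeight hW hw h0 hi hmean _ hL, sub_zero]
  rw [← ENNReal.ofReal_tsum_of_nonneg (fun n => by positivity) hexp.summable, hexp.tsum_eq]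

lemma measurable_markProb (hB : MeasurableSet B) : Measurable (markProb ρ B) :=
  (measurable_measure_prodMk_left hB).ennreal_toReal

lemma intervalIntegrable_markProb (hB : MeasurableSet B) (u v : ℝ) :
    IntervalIntegrable (markProb ρ B) volume u v := by
  rw [intervalIntegrable_iff]
  refine Measure.integrableOn_of_bounded (M := 1) (by simp)
    (measurable_markProb hB).aestronglyMeasurable (Eventually.of_forall fun x => ?_)
  rw [Real.norm_of_nonneg (markProb_nonneg x)]
  exact measureReal_le_one

open scoped Classical in
lemma lintegral_ite_mem {A : Set S} (hA : MeasurableSet A) {s : ℝ} (hs : 0 ≤ s) :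
    ∫⁻ b, (if b ∈ A then ENNReal.ofReal s else 1) ∂ρ =
      ENNReal.ofReal (1 + (s - 1) * ρ.real A) := by
  rw [← lintegral_add_compl _ hA, setLIntegral_congr_fun hA fun b hb => if_pos hb,
    setLIntegral_congr_fun hA.compl fun b hb => if_neg hb, setLIntegral_const, setLIntegral_const,
    one_mul, ← ofReal_measureReal, ← ofReal_measureReal, probReal_compl_eq_one_sub hA,
    ← ENNReal.ofReal_mul hs, ← ENNReal.ofReal_add (mul_nonneg hs measureReal_nonneg)
    (sub_nonneg.2 measureReal_le_one)]
  congr 1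
  ring

open scoped Classical in
lemma lintegral_pow_markedCount (hB : MeasurableSet B) (hL : 0 ≤ L) {s : ℝ} (hs : 0 ≤ s) :
    ∫⁻ ζ, ENNReal.ofReal s ^ markedCount B L ζ ∂markedExpSeq ρ =
      ENNReal.ofReal (Real.exp ((s - 1) * ∫ u in (0 : ℝ)..L, markProb ρ B u)) := by
  have hW : Measurable fun p : ℝ × S => if p ∈ B then ENNReal.ofReal s else 1 :=
    Measurable.ite hB measurable_const measurable_const
  have hw0 (u : ℝ) : 0 ≤ 1 + (s - 1) * markProb ρ B u := by
    nlinarith [markProb_nonneg (ρ := ρ) (B := B) u,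
      measureReal_le_one (μ := ρ) (s := Prod.mk u ⁻¹' B), markProb.eq_1 ρ B u]
  have hi (u v : ℝ) : IntervalIntegrable (fun u => (s - 1) * markProb ρ B u) volume u v :=
    (intervalIntegrable_markProb hB u v).const_mul _
  have hae : (fun ζ => ENNReal.ofReal s ^ markedCount B L ζ) =ᵐ[markedExpSeq ρ]
      fun ζ => ∑' n, pathWeight (fun p => if p ∈ B then ENNReal.ofReal s else 1) L n 0 ζ := by
    filter_upwards [ae_markedExpSeq_nonneg, ae_markedExpSeq_exists_lt L] with ζ h1 h2
    exact (tsum_pathWeight_eq_pow h1 h2 _).symm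
  rw [lintegral_congr_ae hae, lintegral_tsum_pathWeight hW
    ((measurable_markProb hB).const_mul _ |>.const_add _) hw0
    (fun u v => intervalIntegrable_const.add (hi u v))
    (fun u => lintegral_ite_mem (measurable_prodMk_left hB) hs) hL,
    intervalIntegral.integral_add intervalIntegrable_const (hi 0 L),
    intervalIntegral.integral_const_mul]
  simp

lemma map_eq_poissonMeasure_of_lintegral_exp {Ω : Type*} [MeasurableSpace Ω] {P : Measure Ω}
    [IsProbabilityMeasure P] {N : Ω → ℕ} (hN : Measurable N) {r : ℝ≥0}
    (h : ∀ θ : ℝ, ∫⁻ ω, ENNReal.ofReal (Real.exp (θ * N ω)) ∂P =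
      ENNReal.ofReal (Real.exp (r * (Real.exp θ - 1)))) :
    P.map N = poissonMeasure r := by
  have hX : Measurable fun ω => (N ω : ℝ) := measurable_from_nat.comp hN
  have hexp (θ : ℝ) : AEStronglyMeasurable (fun ω => Real.exp (θ * N ω)) P :=
    Measurable.aestronglyMeasurable (by fun_prop)
  have hmgf : mgf (fun ω => (N ω : ℝ)) P = mgf (fun k : ℕ => (k : ℝ)) (poissonMeasure r) := by
    funext θ
    rw [mgf_poissonMeasure, mgf, integral_eq_lintegral_of_nonneg_ae
      (Eventually.of_forall fun ω => Real.exp_nonneg _) (hexp θ), h,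
      ENNReal.toReal_ofReal (Real.exp_nonneg _)]
  have hset : integrableExpSet (fun ω => (N ω : ℝ)) P = univ :=
    eq_univ_of_forall fun θ => ⟨hexp θ, by
      rw [hasFiniteIntegral_iff_ofReal (Eventually.of_forall fun ω => Real.exp_nonneg _), h]
      exact ENNReal.ofReal_lt_top⟩
  have hcomplex := Measure.ext_of_complexMGF_eq hX.aemeasurable
    (measurable_from_nat (f := fun k : ℕ => (k : ℝ))).aemeasurable
    (funext fun c => eqOn_complexMGF_of_mgf hmgf (by simp [hset]))
  refine Nat.isClosedEmbedding_coe_real.measurableEmbedding.map_injective ?_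
  rw [Measure.map_map measurable_from_nat hN]
  exact hcomplex

theorem map_markedCount (hB : MeasurableSet B) (hL : 0 ≤ L) :
    (markedExpSeq ρ).map (markedCount B L) =
      poissonMeasure (∫ u in (0 : ℝ)..L, markProb ρ B u).toNNReal := by
  have hcount : Measurable (markedCount B L) :=
    measurable_markedCount (B := fun _ : ℕ → ℝ × S => B) (hB.preimage measurable_snd)
      measurable_const measurable_id
  refine map_eq_poissonMeasure_of_lintegral_exp hcount fun θ => ?_
  rw [Real.coe_toNNReal _ (intervalIntegral.integral_nonneg hL fun u _ => markProb_nonneg u),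
    mul_comm, ← lintegral_pow_markedCount hB hL (Real.exp_nonneg θ)]
  refine lintegral_congr fun ζ => ?_
  rw [← ENNReal.ofReal_pow (Real.exp_nonneg _), ← Real.exp_nat_mul, mul_comm]

end MarkedPoisson

/-! ### Càdlàg paths -/

section Measurability

variable {X : Type*} [MeasurableSpace X]

lemma measurable_intervalIntegral {g : X × ℝ → ℝ} (hg : Measurable g) (a b : ℝ) :
    Measurable fun x => ∫ r in a..b, g (x, r) :=
  hg.stronglyMeasurable.integral_prod_right'.measurable.sub
    hg.stronglyMeasurable.integral_prod_right'.measurable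

lemma tendsto_floor_mul_add_one_div (s : ℝ≥0) :
    Tendsto (fun n : ℕ => ((⌊(n + 1) * s⌋₊ + 1) / (n + 1) : ℝ≥0)) atTop (𝓝[≥] s) := by
  have hge (n : ℕ) : s ≤ (⌊(n + 1) * s⌋₊ + 1) / (n + 1) := by
    rw [le_div_iff₀ (by positivity), mul_comm]
    exact (Nat.lt_floor_add_one _).le
  have hle (n : ℕ) : (⌊(n + 1) * s⌋₊ + 1 : ℝ≥0) / (n + 1) ≤ s + 1 / (n + 1) := by
    rw [add_div, add_le_add_iff_right, div_le_iff₀ (by positivity), mul_comm s]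
    exact Nat.floor_le zero_le
  have hlim : Tendsto (fun n : ℕ => s + 1 / ((n : ℝ≥0) + 1)) atTop (𝓝 s) := by
    simpa using (tendsto_one_div_add_atTop_nhds_zero_nat (𝕜 := ℝ≥0)).const_add s
  exact tendsto_nhdsWithin_iff.2 ⟨tendsto_of_tendsto_of_tendsto_of_le_of_le tendsto_const_nhds
    hlim hge hle, Eventually.of_forall hge⟩

lemma measurable_uncurry_of_continuousWithinAt_Ici {β : Type*} [TopologicalSpace β]
    [TopologicalSpace.PseudoMetrizableSpace β] [MeasurableSpace β] [BorelSpace β]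
    {u : ℝ≥0 → X → β} (hu : ∀ x s, ContinuousWithinAt (fun s => u s x) (Ici s) s)
    (h : ∀ s, Measurable (u s)) : Measurable (Function.uncurry u) := by
  have hlim (p : ℝ≥0 × X) : Tendsto (fun n : ℕ => u ((⌊(n + 1) * p.1⌋₊ + 1) / (n + 1)) p.2) atTop
      (𝓝 (u p.1 p.2)) :=
    (hu p.2 p.1).tendsto.comp (tendsto_floor_mul_add_one_div p.1)
  have hcount (g : ℕ → ℝ≥0) : Measurable fun q : X × ℕ => u (g q.2) q.1 :=
    measurable_from_prod_countable_left fun j => h (g j)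
  refine measurable_of_tendsto_metrizable (fun n => ?_) (tendsto_pi_nhds.2 hlim)
  exact (hcount fun j => (j + 1) / (n + 1)).comp
    (f := fun p : ℝ≥0 × X => (p.2, ⌊(n + 1) * p.1⌋₊))
    (measurable_snd.prodMk (Nat.measurable_floor.comp (by fun_prop)))

end Measurability

/-- The càdlàg paths in `E`, with the `σ`-algebra generated by the coordinates. -/
abbrev CadlagPath (E : Type*) [TopologicalSpace E] := {f : ℝ≥0 → E // IsCadlag f}

section Cumulative

variable {E : Type*} {c : E → ℝ≥0} {f : ℝ≥0 → E}

lemma cumulative_nonneg {u v : ℝ≥0} (h : u ≤ v) : 0 ≤ cumulative c f u v :=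
  intervalIntegral.integral_nonneg h fun _ _ => NNReal.coe_nonneg _

variable [TopologicalSpace E]

lemma IsCadlag.exists_le (hf : IsCadlag f) (hc : Continuous c) (T : ℝ≥0) :
    ∃ M, ∀ s ≤ T, c (f s) ≤ M := by
  have hlocal (x : ℝ≥0) : ∃ M, ∀ᶠ y in 𝓝 x, c (f y) ≤ M := by
    obtain ⟨hr, l, hl⟩ := hf x
    refine ⟨max (c (f x) + 1) (c l + 1), ?_⟩
    rw [← nhdsLT_sup_nhdsGE x, eventually_sup]
    exact ⟨((hc.tendsto _).comp hl).eventually_le_const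
        ((lt_add_one _).trans_le (le_max_right _ _)),
      ((hc.tendsto _).comp hr).eventually_le_const ((lt_add_one _).trans_le (le_max_left _ _))⟩
  have hbdd : BddAbove ((fun s => c (f s)) '' Icc 0 T) := by
    refine isCompact_Icc.induction_on (p := fun S => BddAbove ((fun s => c (f s)) '' S)) (by simp)
      (fun _ _ hst h => h.mono (image_mono hst)) (fun s t hs ht => ?_) fun x _ => ?_
    · rw [image_union]
      exact hs.union ht
    · obtain ⟨M, hM⟩ := hlocal x
      exact ⟨_, mem_nhdsWithin_of_mem_nhds hM, M, forall_mem_image.2 fun _ hy => hy⟩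
  exact hbdd.imp fun M hM s hs => hM (mem_image_of_mem _ ⟨zero_le, hs⟩)

variable [MeasurableSpace E] [OpensMeasurableSpace E] {X : Type*} [MeasurableSpace X]
  {F : X → CadlagPath E}

lemma measurable_rate (hc : Continuous c) (hF : Measurable F) {s : X → ℝ≥0} (hs : Measurable s) :
    Measurable fun x => c ((F x).1 (s x)) :=
  (measurable_uncurry_of_continuousWithinAt_Ici (u := fun s (f : CadlagPath E) => c (f.1 s))
    (fun f s => hc.continuousAt.comp_continuousWithinAt (f.2 s).1)
    fun s => hc.measurable.comp ((measurable_pi_apply s).comp measurable_subtype_coe)).comp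
    (hs.prodMk hF)

lemma IsCadlag.measurable_rate (hf : IsCadlag f) (hc : Continuous c) :
    Measurable fun r : ℝ => (c (f r.toNNReal) : ℝ) :=
  (ModulatedQueue.measurable_rate hc (F := fun _ => ⟨f, hf⟩) measurable_const
    measurable_real_toNNReal).coe_nnreal_real

lemma IsCadlag.intervalIntegrable_rate (hf : IsCadlag f) (hc : Continuous c) (u v : ℝ) :
    IntervalIntegrable (fun r : ℝ => (c (f r.toNNReal) : ℝ)) volume u v := by
  obtain ⟨M, hM⟩ := hf.exists_le hc (max u v).toNNReal
  rw [intervalIntegrable_iff]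
  refine Measure.integrableOn_of_bounded (M := M) (by simp)
    (hf.measurable_rate hc).aestronglyMeasurable ?_
  filter_upwards [ae_restrict_mem measurableSet_uIoc] with x hx
  rw [Real.norm_of_nonneg (NNReal.coe_nonneg _), NNReal.coe_le_coe]
  exact hM _ (Real.toNNReal_le_toNNReal hx.2)

lemma monotone_cumulative (hf : IsCadlag f) (hc : Continuous c) :
    Monotone fun s => cumulative c f 0 s := fun _ _ h =>
  monotone_primitive (fun _ => NNReal.coe_nonneg _) (hf.intervalIntegrable_rate hc) _
    (NNReal.coe_le_coe.2 h)

lemma continuous_cumulative (hf : IsCadlag f) (hc : Continuous c) :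
    Continuous fun s => cumulative c f 0 s :=
  (intervalIntegral.continuous_primitive (hf.intervalIntegrable_rate hc) _).comp
    NNReal.continuous_coe

lemma measurable_cumulative_zero (hc : Continuous c) (hF : Measurable F) {s : X → ℝ≥0}
    (hs : Measurable s) : Measurable fun x => cumulative c (F x).1 0 (s x) := by
  have hfixed (s : ℝ≥0) : Measurable fun f : CadlagPath E => cumulative c f.1 0 s :=
    measurable_intervalIntegral (g := fun p : CadlagPath E × ℝ => (c (p.1.1 p.2.toNNReal) : ℝ))
      (measurable_rate hc measurable_fst measurable_snd.real_toNNReal).coe_nnreal_real _ _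
  exact (measurable_uncurry_of_continuous_of_measurable
    (u := fun s (f : CadlagPath E) => cumulative c f.1 0 s)
    (fun f => continuous_cumulative f.2 hc) hfixed).comp (hs.prodMk hF)

lemma measurable_cumulative (hc : Continuous c) (hF : Measurable F) {u v : X → ℝ≥0}
    (hu : Measurable u) (hv : Measurable v) :
    Measurable fun x => cumulative c (F x).1 (u x) (v x) := by
  have hsub (x : X) : cumulative c (F x).1 (u x) (v x) =
      cumulative c (F x).1 0 (v x) - cumulative c (F x).1 0 (u x) :=
    have hi := (F x).2.intervalIntegrable_rate hc
    (intervalIntegral.integral_interval_sub_left (hi _ _) (hi _ _)).symm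
  simp only [hsub]
  exact (measurable_cumulative_zero hc hF hv).sub (measurable_cumulative_zero hc hF hu)

end Cumulative

/-! ### The queue along a fixed background path -/

section FirstPassage

variable {E : Type*} {lam kap mu : E → ℝ≥0} {f : ℝ≥0 → E} {t : ℝ≥0}

/-- The first time at which the cumulative rate reaches the level `u`, and `∞` if it never does. -/
noncomputable def firstPassage (lam : E → ℝ≥0) (f : ℝ≥0 → E) (u : ℝ) : ℝ≥0∞ :=
  ⨅ (s : ℝ≥0) (_ : u ≤ cumulative lam f 0 s), (s : ℝ≥0∞)

/-- The pairs of an arrival time, on the scale of the unit-rate Poisson process, and a standardized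
service requirement such that the service of the job is not completed at time `t`. -/
def inSystem (lam kap mu : E → ℝ≥0) (f : ℝ≥0 → E) (t : ℝ≥0) : Set (ℝ × ℝ) :=
  {p | ((cumulative mu f (firstPassage lam f p.1).toNNReal t : ℝ) : EReal) <
    serviceRequirement kap (f (firstPassage lam f p.1).toNNReal) p.2}

lemma expMeasure_real_lt_serviceRequirement (kap : E → ℝ≥0) (x : E) {c : ℝ} (hc : 0 ≤ c) :
    (expMeasure 1).real {z | (c : EReal) < serviceRequirement kap x z} =
      Real.exp (-(kap x * c)) := by
  rcases eq_zero_or_pos (kap x) with h0 | hpos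
  · simp [serviceRequirement, h0]
  · have hset : {z | (c : EReal) < serviceRequirement kap x z} = Ioi (kap x * c) := by
      ext z
      rw [mem_ofPred_eq, serviceRequirement, if_pos hpos, EReal.coe_lt_coe_iff,
        lt_div_iff₀' (NNReal.coe_pos.2 hpos), mem_Ioi]
    rw [hset, measureReal_def, expMeasure_one_Ioi (by positivity),
      ENNReal.toReal_ofReal (Real.exp_nonneg _)]

lemma markProb_inSystem {u : ℝ} {τ : ℝ≥0} (hu : firstPassage lam f u = τ) (hτ : τ ≤ t) :
    markProb (expMeasure 1) (inSystem lam kap mu f t) u =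
      Real.exp (-(kap (f τ) * cumulative mu f τ t)) := by
  rw [← expMeasure_real_lt_serviceRequirement kap (f τ) (cumulative_nonneg hτ), markProb]
  simp only [inSystem, preimage_ofPred_eq, hu, ENNReal.toNNReal_coe]

lemma randomParameter_nonneg (lam kap mu : E → ℝ≥0) (t : ℝ≥0) (f : ℝ≥0 → E) :
    0 ≤ randomParameter lam kap mu t f :=
  intervalIntegral.integral_nonneg t.coe_nonneg fun _ _ => by positivity

/-- The random parameter `φ_t(f)` as a nonnegative real number: the parameter of the Poisson law of
the number of jobs in the system at time `t` along the background path `f`. -/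
noncomputable def poissonParameter (lam kap mu : E → ℝ≥0) (t : ℝ≥0) (f : ℝ≥0 → E) : ℝ≥0 :=
  ⟨randomParameter lam kap mu t f, randomParameter_nonneg lam kap mu t f⟩

lemma coe_poissonParameter :
    (poissonParameter lam kap mu t f : ℝ) = randomParameter lam kap mu t f :=
  rfl

lemma poissonParameter_natCast_mul (n : ℕ) :
    poissonParameter (fun x => (n : ℝ≥0) * lam x) kap mu t f =
      n * poissonParameter lam kap mu t f :=
  NNReal.eq <| by
    simp only [coe_poissonParameter, randomParameter, NNReal.coe_mul, NNReal.coe_natCast,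
      mul_assoc, intervalIntegral.integral_const_mul]

variable [TopologicalSpace E] [MeasurableSpace E] [OpensMeasurableSpace E]

lemma firstPassage_le_iff (hf : IsCadlag f) (hlam : Continuous lam) {u : ℝ} {s : ℝ≥0} :
    firstPassage lam f u ≤ s ↔ u ≤ cumulative lam f 0 s := by
  refine ⟨fun h => ?_, fun h => iInf₂_le s h⟩
  have hgt : ∀ s' > s, u ≤ cumulative lam f 0 s' := fun s' hs' => by
    obtain ⟨r, hr⟩ := iInf_lt_iff.1 (h.trans_lt (ENNReal.coe_lt_coe.2 hs'))
    obtain ⟨hur, hrs⟩ := iInf_lt_iff.1 hr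
    exact hur.trans (monotone_cumulative hf hlam (ENNReal.coe_lt_coe.1 hrs).le)
  exact ge_of_tendsto ((continuous_cumulative hf hlam).continuousWithinAt (s := Ioi s) (x := s))
    (eventually_mem_nhdsWithin.mono hgt)

lemma firstPassage_cumulative (hf : IsCadlag f) (hlam : Continuous lam) {s : ℝ≥0}
    (hs : ∀ s' < s, cumulative lam f 0 s' < cumulative lam f 0 s) :
    firstPassage lam f (cumulative lam f 0 s) = s := by
  refine le_antisymm ((firstPassage_le_iff hf hlam).2 le_rfl) (le_of_not_gt fun hlt => ?_)
  obtain ⟨s', h1, h2⟩ := ENNReal.lt_iff_exists_nnreal_btwn.1 hlt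
  exact ((firstPassage_le_iff hf hlam).1 h1.le).not_gt (hs s' (ENNReal.coe_lt_coe.1 h2))

lemma jobsInSystem_eq_markedCount (hf : IsCadlag f) (hlam : Continuous lam) (ζ : ℕ → ℝ × ℝ) :
    jobsInSystem lam kap mu f (fun k => (ζ k).1) (fun k => (ζ k).2) t =
      markedCount (inSystem lam kap mu f t) (cumulative lam f 0 t) ζ :=
  congrArg ncard (ext fun _ => and_congr_left' (firstPassage_le_iff hf hlam))

variable {X : Type*} [MeasurableSpace X] {F : X → CadlagPath E}

lemma measurable_firstPassage (hlam : Continuous lam) (hF : Measurable F) {u : X → ℝ}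
    (hu : Measurable u) : Measurable fun x => firstPassage lam (F x).1 (u x) := by
  refine measurable_of_Iic fun a => ?_
  induction a with
  | top => simp
  | coe s =>
    have hset : (fun x => firstPassage lam (F x).1 (u x)) ⁻¹' Iic ↑s =
        {x | u x ≤ cumulative lam (F x).1 0 s} :=
      ext fun x => firstPassage_le_iff (F x).2 hlam
    rw [hset]
    exact measurableSet_le hu (measurable_cumulative_zero hlam hF measurable_const)

variable (hlam : Continuous lam) (hkap : Continuous kap) (hmu : Continuous mu)
include hlam hkap hmu

lemma measurableSet_mem_inSystem (hF : Measurable F) {p : X → ℝ × ℝ} (hp : Measurable p) :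
    MeasurableSet {x | p x ∈ inSystem lam kap mu (F x).1 t} := by
  have hτ : Measurable fun x => (firstPassage lam (F x).1 (p x).1).toNNReal :=
    (measurable_firstPassage hlam hF hp.fst).ennreal_toNNReal
  have hk := measurable_rate hkap hF hτ
  exact measurableSet_lt (measurable_cumulative hmu hF hτ measurable_const).coe_real_ereal
    (Measurable.ite (measurableSet_lt measurable_const hk)
      (hp.snd.div hk.coe_nnreal_real).coe_real_ereal measurable_const)

lemma measurableSet_inSystem (hf : IsCadlag f) : MeasurableSet (inSystem lam kap mu f t) :=
  measurableSet_mem_inSystem hlam hkap hmu (F := fun _ => ⟨f, hf⟩) measurable_const measurable_id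

lemma measurable_jobsInSystem (hF : Measurable F) {ζ : X → ℕ → ℝ × ℝ} (hζ : Measurable ζ) :
    Measurable fun x =>
      jobsInSystem lam kap mu (F x).1 (fun k => (ζ x k).1) (fun k => (ζ x k).2) t := by
  simp only [jobsInSystem_eq_markedCount (F _).2 hlam]
  exact measurable_markedCount
    (measurableSet_mem_inSystem hlam hkap hmu (hF.comp measurable_fst) measurable_snd)
    (measurable_cumulative_zero hlam hF measurable_const) hζ

lemma measurable_poissonParameter (hF : Measurable F) :
    Measurable fun x => poissonParameter lam kap mu t (F x).1 := by
  have hpath : Measurable fun q : X × ℝ => F q.1 := hF.comp measurable_fst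
  have htime : Measurable fun q : X × ℝ => q.2.toNNReal := by fun_prop
  exact Measurable.subtype_mk <| measurable_intervalIntegral (g := fun q : X × ℝ =>
    (lam ((F q.1).1 q.2.toNNReal) : ℝ) * Real.exp (-(kap ((F q.1).1 q.2.toNNReal) *
      cumulative mu (F q.1).1 q.2.toNNReal t)))
    ((measurable_rate hlam hpath htime).coe_nnreal_real.mul
      ((measurable_rate hkap hpath htime).coe_nnreal_real.mul
        (measurable_cumulative hmu hpath htime measurable_const)).neg.exp) _ _

lemma integral_markProb_inSystem (hf : IsCadlag f) :
    ∫ u in (0 : ℝ)..cumulative lam f 0 t, markProb (expMeasure 1) (inSystem lam kap mu f t) u =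
      randomParameter lam kap mu t f := by
  have hprob : Measurable (markProb (expMeasure 1) (inSystem lam kap mu f t)) :=
    measurable_markProb (measurableSet_inSystem hlam hkap hmu hf)
  have ht : (0 : ℝ) ≤ t := t.coe_nonneg
  have hw := hf.measurable_rate hlam
  have hw0 (r : ℝ) : (0 : ℝ) ≤ lam (f r.toNNReal) := NNReal.coe_nonneg _
  have hi := hf.intervalIntegrable_rate hlam
  rw [randomParameter, cumulative, NNReal.coe_zero, ← integral_comp_primitive hw hw0 hi ht hprob]
  refine intervalIntegral.integral_congr_ae ?_
  rw [uIoc_of_le ht, ← ae_restrict_iff' measurableSet_Ioc]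
  filter_upwards [ae_primitive_lt hw hw0 hi ht, ae_restrict_mem measurableSet_Ioc]
    with s hs hsI
  have hs0 : (s.toNNReal : ℝ) = s := Real.coe_toNNReal s hsI.1.le
  have hprim : ∫ r in (0 : ℝ)..s, (lam (f r.toNNReal) : ℝ) = cumulative lam f 0 s.toNNReal := by
    rw [cumulative, hs0, NNReal.coe_zero]
  rcases eq_or_ne (lam (f s.toNNReal) : ℝ) 0 with h0 | hne
  · rw [h0, zero_mul, zero_mul]
  have hpass : firstPassage lam f (cumulative lam f 0 s.toNNReal) = s.toNNReal :=
    firstPassage_cumulative hf hlam fun s' hs' =>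
      (hs hne s' (Real.lt_toNNReal_iff_coe_lt.1 hs')).trans_eq hprim
  rw [hprim, markProb_inSystem hpass (Real.toNNReal_le_iff_le_coe.2 hsI.2)]

theorem map_jobsInSystem (hf : IsCadlag f) :
    (markedExpSeq (expMeasure 1)).map
        (fun ζ => jobsInSystem lam kap mu f (fun k => (ζ k).1) (fun k => (ζ k).2) t) =
      poissonMeasure (poissonParameter lam kap mu t f) := by
  simp only [jobsInSystem_eq_markedCount hf hlam]
  rw [map_markedCount (measurableSet_inSystem hlam hkap hmu hf) (cumulative_nonneg zero_le),
    integral_markProb_inSystem hlam hkap hmu hf,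
    Real.toNNReal_of_nonneg (randomParameter_nonneg lam kap mu t f)]
  rfl

end FirstPassage

/-! ### The queue with a random background process -/

section Input

lemma map_infinitePi_sum {ι X : Type*} [MeasurableSpace X] (μ : Measure X)
    [IsProbabilityMeasure μ] :
    (Measure.infinitePi fun _ : ι ⊕ ι => μ).map
        (fun x k => (x (Sum.inl k), x (Sum.inr k))) =
      Measure.infinitePi fun _ : ι => μ.prod μ := by
  set e : ι × Bool → ι ⊕ ι := fun p => Equiv.boolProdEquivSum ι p.swap
  have he : Function.Injective e := (Equiv.boolProdEquivSum ι).injective.comp Prod.swap_injective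
  have hpair : Measurable fun y : Bool → X => (y false, y true) := by fun_prop
  have hreindex : Measurable fun (x : ι ⊕ ι → X) p => x (e p) := by fun_prop
  rw [← Measure.infinitePi_map_eval_prod (P := fun _ : Bool => μ) Bool.false_ne_true,
    ← Measure.infinitePi_map_pi (fun _ => Measure.infinitePi fun _ : Bool => μ) (fun _ => hpair),
    ← Measure.infinitePi_map_curry fun _ _ => μ,
    ← Measure.map_infinitePi_infinitePi_of_inj (P := fun _ : ι ⊕ ι => μ) he,
    Measure.map_map (MeasurableEquiv.measurable _) hreindex, Measure.map_map (by fun_prop)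
      ((MeasurableEquiv.measurable _).comp hreindex)]
  rfl

variable {Ω E : Type*} [MeasurableSpace Ω] [TopologicalSpace E] [MeasurableSpace E]
  {P : Measure Ω} {J : ℝ≥0 → Ω → E} {σ Z : ℕ → Ω → ℝ}

namespace IsQueueInput

variable (hQ : IsQueueInput P J σ Z)
include hQ

lemma isProbabilityMeasure : IsProbabilityMeasure P :=
  hQ.indep_exponentials.isProbabilityMeasure

lemma measurable_exponentials : Measurable fun ω k => (σ k ω, Z k ω) :=
  measurable_pi_lambda _ fun k =>
    (hQ.measurable_interarrival k).prodMk (hQ.measurable_service k)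

lemma map_exponentials :
    P.map (fun ω k => (σ k ω, Z k ω)) = markedExpSeq (expMeasure 1) := by
  have hlaw : ∀ i, HasLaw (Sum.elim σ Z i) (expMeasure 1) P :=
    Sum.forall.2 ⟨hQ.law_interarrival, hQ.law_service⟩
  have hmeas : Measurable fun ω i => Sum.elim σ Z i ω :=
    measurable_pi_lambda _ (Sum.forall.2 ⟨hQ.measurable_interarrival, hQ.measurable_service⟩)
  rw [markedExpSeq, ← map_infinitePi_sum,
    ← (hQ.indep_exponentials.hasLaw_infinitePi hlaw hmeas.aemeasurable).map_eq,
    Measure.map_map (by fun_prop) hmeas]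
  rfl

/-- The background process as a random element of the space of càdlàg paths. -/
def path (ω : Ω) : CadlagPath E := ⟨fun s => J s ω, hQ.cadlag ω⟩

lemma measurable_path : Measurable hQ.path :=
  (measurable_pi_lambda _ hQ.measurable_background).subtype_mk

lemma indepFun_path : IndepFun hQ.path (fun ω k => (σ k ω, Z k ω)) P := by
  have hpairs : Measurable fun (y : ℕ ⊕ ℕ → ℝ) k => (y (Sum.inl k), y (Sum.inr k)) := by fun_prop
  have hindep : IndepFun (fun ω s => J s ω) (fun ω k => (σ k ω, Z k ω)) P :=
    hQ.indep_background.comp measurable_id hpairs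
  rw [indepFun_iff_measure_inter_preimage_eq_mul] at hindep ⊢
  rintro _ T ⟨S, hS, rfl⟩ hT
  exact hindep S T hS hT

lemma map_path_exponentials :
    P.map (fun ω => (hQ.path ω, fun k => (σ k ω, Z k ω))) =
      (P.map hQ.path).prod (markedExpSeq (expMeasure 1)) := by
  have := hQ.isProbabilityMeasure
  rw [hQ.indepFun_path.map_prod_eq_prod_map_map hQ.measurable_path.aemeasurable
    hQ.measurable_exponentials.aemeasurable, hQ.map_exponentials]

variable [OpensMeasurableSpace E] {lam kap mu : E → ℝ≥0} (hlam : Continuous lam)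
  (hkap : Continuous kap) (hmu : Continuous mu) (t : ℝ≥0)
include hlam hkap hmu

lemma measurable_poissonParameter :
    Measurable fun ω => poissonParameter lam kap mu t fun s => J s ω :=
  ModulatedQueue.measurable_poissonParameter hlam hkap hmu hQ.measurable_path

lemma parameterLaw_eq_map : parameterLaw P lam kap mu J t =
    (P.map fun ω => poissonParameter lam kap mu t fun s => J s ω).map NNReal.toReal := by
  rw [Measure.map_map measurable_coe_nnreal_real (hQ.measurable_poissonParameter hlam hkap hmu t)]
  rfl

lemma scaledJobsLaw_eq_comp (n : ℕ) : scaledJobsLaw P lam kap mu J σ Z t n =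
    poissonKernel n ∘ₘ P.map fun ω => poissonParameter lam kap mu t fun s => J s ω := by
  have hlam' : Continuous fun x => (n : ℝ≥0) * lam x := hlam.const_mul _
  have hjobs : Measurable fun q : CadlagPath E × (ℕ → ℝ × ℝ) => (jobsInSystem
      (fun x => n * lam x) kap mu q.1.1 (fun k => (q.2 k).1) (fun k => (q.2 k).2) t : ℝ) / n :=
    (measurable_from_nat (f := fun k : ℕ => (k : ℝ) / n)).comp
      (measurable_jobsInSystem hlam' hkap hmu measurable_fst measurable_snd)
  have hmap : scaledJobsLaw P lam kap mu J σ Z t n =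
      ((P.map hQ.path).prod (markedExpSeq (expMeasure 1))).map fun q => (jobsInSystem
        (fun x => n * lam x) kap mu q.1.1 (fun k => (q.2 k).1) (fun k => (q.2 k).2) t : ℝ) / n := by
    rw [← hQ.map_path_exponentials, Measure.map_map hjobs
      (hQ.measurable_path.prodMk hQ.measurable_exponentials)]
    rfl
  ext A hA
  rw [hmap, Measure.map_apply hjobs hA, Measure.prod_apply (hjobs hA),
    Measure.bind_apply hA (Kernel.aemeasurable _),
    lintegral_map (measurable_measure_prodMk_left (hjobs hA)) hQ.measurable_path,
    lintegral_map (Kernel.measurable_coe _ hA) (hQ.measurable_poissonParameter hlam hkap hmu t)]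
  refine lintegral_congr fun ω => ?_
  rw [poissonKernel_apply n _ hA, ← poissonParameter_natCast_mul,
    ← map_jobsInSystem hlam' hkap hmu (hQ.cadlag ω), Measure.map_apply ?_ .of_discrete]
  · rfl
  · exact measurable_jobsInSystem hlam' hkap hmu (F := fun _ => hQ.path ω) measurable_const
      measurable_id

end IsQueueInput

end Input

/-! ### Large deviations of mixed Poisson distributions -/

lemma SatisfiesLDP.mem_attainable {ν : ℕ → Measure ℝ} {ψ : ℝ → ℝ≥0∞} (h : SatisfiesLDP ν ψ)
    {γ : ℝ≥0} (hγ : ψ γ ≠ ⊤) : γ ∈ attainable ν := fun ε hε => by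
  have hcost : ⨅ a ∈ Metric.ball (γ : ℝ) ε, ψ a ≠ ⊤ :=
    ne_top_of_le_ne_top hγ (iInf₂_le _ (Metric.mem_ball_self hε))
  have hliminf : ⊥ < liminf (fun n : ℕ => ENNReal.log (ν n (Metric.ball (γ : ℝ) ε)) / (n : EReal))
      atTop := by
    refine lt_of_lt_of_le ?_ (h.lower_bound _ Metric.isOpen_ball)
    rwa [bot_lt_iff_ne_bot, Ne, EReal.neg_eq_bot_iff, EReal.coe_ennreal_eq_top_iff]
  refine eventually_atTop.1 ?_
  filter_upwards [eventually_lt_of_lt_liminf hliminf, eventually_gt_atTop 0] with n hn hpos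
  refine pos_iff_ne_zero.2 fun h0 => hn.ne' ?_
  rw [h0, ENNReal.log_zero, EReal.bot_div_of_pos_ne_top (by exact_mod_cast hpos)
    (EReal.natCast_ne_top n)]

lemma SatisfiesLDP.mixedRate_eq_iInf {ν : ℕ → Measure ℝ} {ψ : ℝ → ℝ≥0∞}
    (h : SatisfiesLDP ν ψ) : mixedRate ν ψ = fun a => ⨅ γ : ℝ≥0, (poissonRate γ a + ψ γ) := by
  refine funext fun a => le_antisymm (le_iInf fun γ => ?_) (le_iInf₂ fun γ _ => iInf_le _ γ)
  rcases eq_or_ne (ψ γ) ⊤ with htop | hfin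
  · simp only [htop, add_top, le_top]
  · exact iInf₂_le γ (h.mem_attainable hfin)

theorem satisfiesLDP_mixedRate {ν : ℕ → Measure ℝ≥0} [∀ n, IsProbabilityMeasure (ν n)]
    {ψ : ℝ → ℝ≥0∞} (h : SatisfiesLDP (fun n => (ν n).map NNReal.toReal) ψ) :
    SatisfiesLDP (fun n => poissonKernel n ∘ₘ ν n)
      (mixedRate (fun n => (ν n).map NNReal.toReal) ψ) := by
  rw [h.mixedRate_eq_iInf]
  exact uniformLDP_poissonKernel.satisfiesLDP_comp
    (h.of_map_isClosedEmbedding NNReal.isClosedEmbedding_coe)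

end ModulatedQueue

theorem theorem1_general {E : Type*} [TopologicalSpace E] [MeasurableSpace E]
    [OpensMeasurableSpace E] (lam kap mu : E → ℝ≥0) (hlam : Continuous lam)
    (hkap : Continuous kap) (hmu : Continuous mu) {Ω : ℕ → Type*} [∀ n, MeasurableSpace (Ω n)]
    (P : ∀ n, Measure (Ω n)) (J : ∀ n, ℝ≥0 → Ω n → E) (σ Z : ∀ n, ℕ → Ω n → ℝ)
    (hQ : ∀ n, ModulatedQueue.IsQueueInput (P n) (J n) (σ n) (Z n))
    (t : ℝ≥0) (ψ : ℝ → ℝ≥0∞)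
    (hψ : ModulatedQueue.SatisfiesLDP
      (fun n => ModulatedQueue.parameterLaw (P n) lam kap mu (J n) t) ψ) :
    ModulatedQueue.SatisfiesLDP
      (fun n => ModulatedQueue.scaledJobsLaw (P n) lam kap mu (J n) (σ n) (Z n) t n)
      (ModulatedQueue.mixedRate
        (fun n => ModulatedQueue.parameterLaw (P n) lam kap mu (J n) t) ψ) := by
  have := fun n => (hQ n).isProbabilityMeasure
  have (n : ℕ) := Measure.isProbabilityMeasure_map (μ := P n)
    ((hQ n).measurable_poissonParameter hlam hkap hmu t).aemeasurable
  simp only [fun n => (hQ n).parameterLaw_eq_map hlam hkap hmu t,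
    fun n => (hQ n).scaledJobsLaw_eq_comp hlam hkap hmu t] at hψ ⊢
  exact ModulatedQueue.satisfiesLDP_mixedRate hψ

theorem theorem1 {E : Type*} [MetricSpace E] [MeasurableSpace E] [BorelSpace E]
    (lam kap mu : E → ℝ≥0) (hlam : Continuous lam) (hkap : Continuous kap) (hmu : Continuous mu)
    {Ω : ℕ → Type*} [∀ n, MeasurableSpace (Ω n)]
    (P : ∀ n, Measure (Ω n)) [∀ n, IsProbabilityMeasure (P n)]
    (J : ∀ n, ℝ≥0 → Ω n → E) (σ Z : ∀ n, ℕ → Ω n → ℝ)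
    (hQ : ∀ n, ModulatedQueue.IsQueueInput (P n) (J n) (σ n) (Z n))
    (t : ℝ≥0) (ψ : ℝ → ℝ≥0∞)
    (hψ : ModulatedQueue.SatisfiesLDP
      (fun n => ModulatedQueue.parameterLaw (P n) lam kap mu (J n) t) ψ) :
    ModulatedQueue.SatisfiesLDP
      (fun n => ModulatedQueue.scaledJobsLaw (P n) lam kap mu (J n) (σ n) (Z n) t n)
      (ModulatedQueue.mixedRate
        (fun n => ModulatedQueue.parameterLaw (P n) lam kap mu (J n) t) ψ) :=
  theorem1_general lam kap mu hlam hkap hmu P J σ Z hQ t ψ hψ
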